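/- Let $N$ be a connected nilpotent (real, finite-dimensional) Lie group with Lie algebra $\mathfrak n$, let $\Gamma\subset N$ be a discrete subgroup such that $M=N/\Gamma$ is compact, and let $L$ be an automorphism of the Lie group $N$ with $L(\Gamma)=\Gamma$; write $L$ also for the induced diffeomorphism $x\Gamma\mapsto L(x)\Gamma$ of $M$. Suppose that $L$ is an Anosov automorphism, i.e. $D_eL\colon\mathfrak n\to\mathfrak n$ has no complex eigenvalue of modulus one, and that $L$ has simple spectrum, i.e. the moduli of the complex eigenvalues of $D_eL$, counted with multiplicity, are pairwise distinct. Let $Z$ be the center of $N$, let $\mathfrak z\subseteq\mathfrak n$ be its Lie algebra, and let $V\subset\mathfrak z$ be the $\mathbb Q$-span of $\{X\in\mathfrak z:\exp X\in\Gamma\}$ (the $\mathbb Q$-structure on $\mathfrak z$ given by $\Gamma$). If $L|_Z$ is reducible over $\mathbb Q$, i.e. there is a $\mathbb Q$-subspace $0\ne W\subsetneq V$ with $D_eL(W)\subseteq W$, then $L$ is not locally periodic data rigid. Here a map of $M$ is $C^{1+}$ if it is $C^1$ and its derivative is $\theta$-Hölder for some $\theta>0$, and $\operatorname{Diff}^{1+}(M)$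 is the set of $C^{1+}$ diffeomorphisms of $M$. A diffeomorphism $f$ of $M$ is locally periodic data rigid if there is a $C^1$-neighborhood $\mathcal U$ of $f$ in $\operatorname{Diff}^{1+}(M)$ such that for every $g\in\mathcal U$ and every homeomorphism $h$ of $M$ with $f=h\circ g\circ h^{-1}$: if for every $n\ge 1$ and every $p\in M$ with $g^n(p)=p$ the linear maps $D_pg^n$ and $D_{h(p)}f^n$ are conjugate, then $h$ is $C^{1+}$. -/

import Mathlib

open Set Filter Topology Function
open scoped Manifold ContDiff NNReal

noncomputable section

/-! ## Periodic data rigidity on a manifold -/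

section Manifold

variable {E : Type*} [NormedAddCommGroup E] [NormedSpace ℝ E]
  {M : Type*} [TopologicalSpace M] [ChartedSpace E M]

/-- A self-map of a manifold is `C^{1+}` if it is `C^1` and its derivative is (locally, in charts)
`θ`-Hölder continuous for some `θ > 0`. On a compact manifold local and global Hölder continuity
are the same. -/
def IsC1Plus (f : M → M) : Prop :=
  ContMDiff 𝓘(ℝ, E) 𝓘(ℝ, E) 1 f ∧
    ∃ θ : ℝ≥0, 0 < θ ∧ ∀ x : M, ∃ C : ℝ≥0, ∃ s ∈ 𝓝 (extChartAt 𝓘(ℝ, E) x x),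
      HolderOnWith C θ (fderiv ℝ (writtenInExtChartAt 𝓘(ℝ, E) 𝓘(ℝ, E) x f)) s

/-- The `C^1` topology on the `C^1` diffeomorphisms of `M`: the topology induced by sending `g`
to its tangent map `Tg : TM → TM`, where `C(TM, TM)` carries the compact-open topology. -/
abbrev c1Topology [IsManifold 𝓘(ℝ, E) 1 M] :
    TopologicalSpace (M ≃ₘ^1⟮𝓘(ℝ, E), 𝓘(ℝ, E)⟯ M) :=
  TopologicalSpace.induced
    (fun g ↦ (⟨tangentMap 𝓘(ℝ, E) 𝓘(ℝ, E) g, g.contMDiff.continuous_tangentMap le_rfl⟩ :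
      C(TangentBundle 𝓘(ℝ, E) M, TangentBundle 𝓘(ℝ, E) M)))
    inferInstance

/-- `f` and `g` have the same periodic data with respect to a conjugacy `h` with
`f = h ∘ g ∘ h⁻¹`: whenever `g^n p = p` with `n ≥ 1`, the linear maps `D_p g^n` and
`D_{h p} f^n` are conjugate. (Every tangent space of `M` is modelled on `E`, and `g^n p = p`,
`f^n (h p) = h p`, so that both differentials are endomorphisms of `E`.) -/
def SamePeriodicData (f g h : M → M) : Prop :=
  ∀ (p : M) (n : ℕ), 0 < n → IsPeriodicPt g n p →
    ∃ A : TangentSpace 𝓘(ℝ, E) p ≃L[ℝ] TangentSpace 𝓘(ℝ, E) (h p),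
      ∀ v : E, A (mfderiv 𝓘(ℝ, E) 𝓘(ℝ, E) g^[n] p v) =
        mfderiv 𝓘(ℝ, E) 𝓘(ℝ, E) f^[n] (h p) (A v)

/-- Local periodic data rigidity of a diffeomorphism `f`: for all `C^{1+}` diffeomorphisms `g` in
some `C^1` neighbourhood of `f` and all topological conjugacies `h` between `f` and `g`,
`f = h ∘ g ∘ h⁻¹`, if `f` and `g` have the same periodic data with respect to `h` then `h` is
`C^{1+}`. -/
def LocallyPeriodicDataRigid [IsManifold 𝓘(ℝ, E) 1 M]
    (f : M ≃ₘ^1⟮𝓘(ℝ, E), 𝓘(ℝ, E)⟯ M) : Prop :=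
  ∃ U ∈ @nhds _ (c1Topology (E := E) (M := M)) f, ∀ g ∈ U, IsC1Plus (E := E) g →
    ∀ h : M ≃ₜ M, (∀ x, f (h x) = h (g x)) → SamePeriodicData (E := E) f g h →
      IsC1Plus (E := E) h

end Manifold

/-! ## The manifold `N ⧸ Γ` of cosets `x Γ` -/

section Quotient

theorem isLocalHomeomorph_quotientMk (E : Type*) [NormedAddCommGroup E] [NormedSpace ℝ E]
    {N : Type*} [TopologicalSpace N] [ChartedSpace E N] [Group N] [LieGroup 𝓘(ℝ, E) ∞ N]
    (Γ : Subgroup N) [DiscreteTopology Γ] :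
    IsLocalHomeomorph (QuotientGroup.mk : N → N ⧸ Γ) := by
  have : IsTopologicalGroup N := topologicalGroup_of_lieGroup 𝓘(ℝ, E) ∞
  exact (Γ.isQuotientCoveringMap ⟨inferInstance⟩).isCoveringMap.isLocalHomeomorph

variable {E : Type*} [NormedAddCommGroup E] [NormedSpace ℝ E]
  {N : Type*} [TopologicalSpace N] [ChartedSpace E N] [Group N]
  [LieGroup 𝓘(ℝ, E) ∞ N] (Γ : Subgroup N) [DiscreteTopology Γ]

/-- The charts of `N ⧸ Γ` are local inverses of the projection `N → N ⧸ Γ` followed by charts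
of `N`. -/
instance quotientChartedSpace : ChartedSpace E (N ⧸ Γ) :=
  (isLocalHomeomorph_quotientMk E Γ).chartedSpace QuotientGroup.mk_surjective

/-- A lift of a point of `N ⧸ Γ` (the one used for the chart at that point). -/
def quotientLift (q : N ⧸ Γ) : N :=
  (QuotientGroup.mk_surjective (s := Γ)).hasRightInverse.choose q

/-- The local inverse of the projection used for the chart at `q`. -/
def quotientSection (q : N ⧸ Γ) : OpenPartialHomeomorph (N ⧸ Γ) N :=
  (isLocalHomeomorph_quotientMk E Γ).localInverseAt (quotientLift Γ q)

/-- Where the local inverse composed with the projection is defined it is locally a right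
translation by an element of `Γ`. -/
lemma quotientSection_mk_eventuallyEq (q : N ⧸ Γ) (x : N)
    (hx : (x : N ⧸ Γ) ∈ (quotientSection (E := E) Γ q).source) :
    ∃ γ : N, (fun y : N ↦ quotientSection (E := E) Γ q (y : N ⧸ Γ)) =ᶠ[𝓝 x] fun y ↦ y * γ := by
  have hl := isLocalHomeomorph_quotientMk E Γ
  set s := quotientSection (E := E) Γ q with hs
  have : IsTopologicalGroup N := topologicalGroup_of_lieGroup 𝓘(ℝ, E) ∞
  have hmk : ∀ z ∈ s.source, ((s z : N) : N ⧸ Γ) = z := fun z hz ↦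
    hl.apply_localInverseAt_of_mem hz
  have hγ : x⁻¹ * s x ∈ Γ := QuotientGroup.eq.1 (hmk _ hx).symm
  refine ⟨x⁻¹ * s x, ?_⟩
  have h1 : ∀ᶠ y : N in 𝓝 x, (y : N ⧸ Γ) ∈ s.source :=
    hl.continuous.continuousAt (s.open_source.mem_nhds hx)
  have h2 : ∀ᶠ y : N in 𝓝 x, y * (x⁻¹ * s x) ∈ s.target := by
    have hc : ContinuousAt (fun y : N ↦ y * (x⁻¹ * s x)) x := by fun_prop
    refine hc (s.open_target.mem_nhds ?_)
    simpa using s.map_source hx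
  filter_upwards [h1, h2] with y hy1 hy2
  refine hl.injOn_localInverseAt_target (s.map_source hy1) hy2 ?_
  rw [hmk _ hy1]
  exact (QuotientGroup.mk_mul_of_mem y hγ).symm

lemma quotient_chartAt (q : N ⧸ Γ) :
    chartAt E q = (quotientSection (E := E) Γ q).trans (chartAt E (quotientLift Γ q)) := rfl

instance quotientIsManifold : IsManifold 𝓘(ℝ, E) ∞ (N ⧸ Γ) := by
  have : IsTopologicalGroup N := topologicalGroup_of_lieGroup 𝓘(ℝ, E) ∞
  apply isManifold_of_contDiffOn
  rintro _ _ ⟨q, rfl⟩ ⟨q', rfl⟩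
  change ContDiffOn ℝ ∞ (𝓘(ℝ, E) ∘ (((quotientSection (E := E) Γ q).trans
    (chartAt E (quotientLift Γ q))).symm.trans ((quotientSection (E := E) Γ q').trans
    (chartAt E (quotientLift Γ q')))) ∘ 𝓘(ℝ, E).symm) (𝓘(ℝ, E).symm ⁻¹' (((quotientSection (E := E) Γ q).trans
    (chartAt E (quotientLift Γ q))).symm.trans ((quotientSection (E := E) Γ q').trans
    (chartAt E (quotientLift Γ q')))).source ∩ range 𝓘(ℝ, E))
  set s := quotientSection (E := E) Γ q
  set s' := quotientSection (E := E) Γ q'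
  set c := chartAt E (quotientLift Γ q) with hc
  set c' := chartAt E (quotientLift Γ q') with hc'
  have hsymm : ∀ y, s.symm y = (y : N ⧸ Γ) := fun y ↦
    congrFun ((isLocalHomeomorph_quotientMk E Γ).localInverseAt_symm _) y
  rintro v ⟨hv, -⟩
  simp only [mfld_simps] at hv
  rw [hsymm] at hv
  obtain ⟨γ, hγ⟩ := quotientSection_mk_eventuallyEq Γ q' (c.symm v) hv.2.1
  refine ContDiffAt.contDiffWithinAt ?_
  have key : ContDiffAt ℝ ∞ (fun w ↦ c' (c.symm w * γ)) v := by
    have h1 : ContMDiffAt 𝓘(ℝ, E) 𝓘(ℝ, E) ∞ c.symm v :=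
      (contMDiffOn_chart_symm (n := ∞)).contMDiffAt (c.open_target.mem_nhds hv.1.1)
    have h2 : ContMDiffAt 𝓘(ℝ, E) 𝓘(ℝ, E) ∞ (fun w ↦ c.symm w * γ) v :=
      h1.mul contMDiffAt_const
    have h3 : ContMDiffAt 𝓘(ℝ, E) 𝓘(ℝ, E) ∞ c' (c.symm v * γ) := by
      refine (contMDiffOn_chart (n := ∞)).contMDiffAt (c'.open_source.mem_nhds ?_)
      rw [← hγ.eq_of_nhds]
      exact hv.2.2
    exact (ContMDiffAt.comp v h3 h2).contDiffAt
  refine key.congr_of_eventuallyEq ?_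
  have hcont : ContinuousAt c.symm v := c.symm.continuousAt hv.1.1
  filter_upwards [hcont.eventually hγ] with w hw
  simp only [mfld_simps]
  rw [hsymm, hw]

/-- The local inverses of the projection are smooth. -/
theorem contMDiffAt_quotientSection (q : N ⧸ Γ) :
    ContMDiffAt 𝓘(ℝ, E) 𝓘(ℝ, E) ∞ (quotientSection (E := E) Γ q) q := by
  set s := quotientSection (E := E) Γ q
  set c := chartAt E (quotientLift Γ q) with hc
  have hq : q ∈ (s.trans c).source := mem_chart_source E q
  have h1 : ContMDiffAt 𝓘(ℝ, E) 𝓘(ℝ, E) ∞ (s.trans c) q :=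
    (contMDiffOn_chart (n := ∞) (x := q)).contMDiffAt ((s.trans c).open_source.mem_nhds hq)
  have h2 : ContMDiffAt 𝓘(ℝ, E) 𝓘(ℝ, E) ∞ c.symm (s.trans c q) :=
    (contMDiffOn_chart_symm (n := ∞)).contMDiffAt
      (c.open_target.mem_nhds (c.map_source hq.2))
  refine (h2.comp q h1).congr_of_eventuallyEq ?_
  filter_upwards [(s.trans c).open_source.mem_nhds hq] with z hz
  exact (c.left_inv hz.2).symm

/-- The projection `N → N ⧸ Γ` is smooth. -/
theorem contMDiff_quotientMk :
    ContMDiff 𝓘(ℝ, E) 𝓘(ℝ, E) ∞ (QuotientGroup.mk : N → N ⧸ Γ) := by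
  intro x
  have hl := isLocalHomeomorph_quotientMk E Γ
  set q : N ⧸ Γ := (x : N ⧸ Γ) with hq
  set s := quotientSection (E := E) Γ q with hs
  set c := chartAt E (quotientLift Γ q) with hc
  have hxq : q ∈ (s.trans c).source := mem_chart_source E q
  obtain ⟨γ, hγ⟩ := quotientSection_mk_eventuallyEq (E := E) Γ q x hxq.1
  have h1 : ContMDiffAt 𝓘(ℝ, E) 𝓘(ℝ, E) ∞ (fun y : N ↦ s (y : N ⧸ Γ)) x :=
    ((contMDiffAt_id (I := 𝓘(ℝ, E))).mul contMDiffAt_const).congr_of_eventuallyEq hγ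
  have h2 : ContMDiffAt 𝓘(ℝ, E) 𝓘(ℝ, E) ∞ c (s q) :=
    (contMDiffOn_chart (n := ∞)).contMDiffAt (c.open_source.mem_nhds hxq.2)
  have h3 : ContMDiffAt 𝓘(ℝ, E) 𝓘(ℝ, E) ∞ (s.trans c).symm (c (s q)) :=
    (contMDiffOn_chart_symm (n := ∞) (x := q)).contMDiffAt
      ((s.trans c).open_target.mem_nhds ((s.trans c).map_source hxq))
  refine (h3.comp x (h2.comp x h1)).congr_of_eventuallyEq ?_
  filter_upwards [hl.continuous.continuousAt ((s.trans c).open_source.mem_nhds hxq)] with y hy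
  exact ((s.trans c).left_inv hy).symm

end Quotient

/-! ## Automorphisms of `N` preserving `Γ` -/

section Automorphism

/-- An automorphism of the Lie group `N` that maps `Γ` onto itself. -/
structure LatticeAut (E : Type*) [NormedAddCommGroup E] [NormedSpace ℝ E]
    {N : Type*} [TopologicalSpace N] [ChartedSpace E N] [Group N] (Γ : Subgroup N) where
  toMulEquiv : N ≃* N
  contMDiff_toFun : ContMDiff 𝓘(ℝ, E) 𝓘(ℝ, E) ∞ toMulEquiv
  contMDiff_invFun : ContMDiff 𝓘(ℝ, E) 𝓘(ℝ, E) ∞ toMulEquiv.symm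
  map_eq : Γ.map toMulEquiv.toMonoidHom = Γ

variable {E : Type*} [NormedAddCommGroup E] [NormedSpace ℝ E]
  {N : Type*} [TopologicalSpace N] [ChartedSpace E N] [Group N]
  {Γ : Subgroup N}

namespace LatticeAut

theorem mem_iff (L : LatticeAut E Γ) (x : N) : L.toMulEquiv x ∈ Γ ↔ x ∈ Γ := by
  constructor
  · intro h
    obtain ⟨y, hy, hyx⟩ := (SetLike.ext_iff.1 L.map_eq _).2 h
    have : y = x := L.toMulEquiv.injective hyx
    exact this ▸ hy
  · intro h
    exact (SetLike.ext_iff.1 L.map_eq _).1 ⟨x, h, rfl⟩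

/-- The induced bijection `x Γ ↦ L(x) Γ` of `N ⧸ Γ`. -/
def quotientEquiv (L : LatticeAut E Γ) : (N ⧸ Γ) ≃ (N ⧸ Γ) :=
  Quotient.congr L.toMulEquiv.toEquiv fun a b ↦ by
    change QuotientGroup.leftRel Γ a b ↔
      QuotientGroup.leftRel Γ (L.toMulEquiv a) (L.toMulEquiv b)
    rw [QuotientGroup.leftRel_apply, QuotientGroup.leftRel_apply, ← map_inv, ← map_mul, L.mem_iff]

theorem quotientEquiv_mk (L : LatticeAut E Γ) (x : N) :
    L.quotientEquiv (x : N ⧸ Γ) = ((L.toMulEquiv x : N) : N ⧸ Γ) := rfl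

theorem quotientEquiv_symm_mk (L : LatticeAut E Γ) (x : N) :
    L.quotientEquiv.symm (x : N ⧸ Γ) = ((L.toMulEquiv.symm x : N) : N ⧸ Γ) := rfl

/-- The induced diffeomorphism `x Γ ↦ L(x) Γ` of `N ⧸ Γ`. -/
def quotientDiffeo [LieGroup 𝓘(ℝ, E) ∞ N] [DiscreteTopology Γ] (L : LatticeAut E Γ) :
    (N ⧸ Γ) ≃ₘ^1⟮𝓘(ℝ, E), 𝓘(ℝ, E)⟯ (N ⧸ Γ) where
  toEquiv := L.quotientEquiv
  contMDiff_toFun := by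
    intro q
    have h1 := contMDiffAt_quotientSection (E := E) Γ q
    have h2 : ContMDiffAt 𝓘(ℝ, E) 𝓘(ℝ, E) ∞ (fun x : N ↦ (L.toMulEquiv x : N ⧸ Γ))
        (quotientSection (E := E) Γ q q) :=
      ((contMDiff_quotientMk Γ).comp L.contMDiff_toFun).contMDiffAt
    have hq : q ∈ (quotientSection (E := E) Γ q).source := (mem_chart_source E q).1
    refine ((h2.comp q h1).congr_of_eventuallyEq ?_).of_le (by simp)
    filter_upwards [(quotientSection (E := E) Γ q).open_source.mem_nhds hq] with z hz
    conv_lhs =>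
      rw [← (isLocalHomeomorph_quotientMk E Γ).apply_localInverseAt_of_mem hz]
    rfl
  contMDiff_invFun := by
    intro q
    have h1 := contMDiffAt_quotientSection (E := E) Γ q
    have h2 : ContMDiffAt 𝓘(ℝ, E) 𝓘(ℝ, E) ∞ (fun x : N ↦ (L.toMulEquiv.symm x : N ⧸ Γ))
        (quotientSection (E := E) Γ q q) :=
      ((contMDiff_quotientMk Γ).comp L.contMDiff_invFun).contMDiffAt
    have hq : q ∈ (quotientSection (E := E) Γ q).source := (mem_chart_source E q).1
    refine ((h2.comp q h1).congr_of_eventuallyEq ?_).of_le (by simp)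
    filter_upwards [(quotientSection (E := E) Γ q).open_source.mem_nhds hq] with z hz
    conv_lhs =>
      rw [← (isLocalHomeomorph_quotientMk E Γ).apply_localInverseAt_of_mem hz]
    rfl

instance groupLieAlgebraFinite [FiniteDimensional ℝ E] :
    Module.Finite ℝ (GroupLieAlgebra 𝓘(ℝ, E) N) :=
  inferInstanceAs (Module.Finite ℝ E)

/-- The differential of `L` at the identity, acting on the Lie algebra of `N`. As `L 1 = 1` it is
an endomorphism of the tangent space at `1`. -/
def differential (L : LatticeAut E Γ) :
    GroupLieAlgebra 𝓘(ℝ, E) N →ₗ[ℝ] GroupLieAlgebra 𝓘(ℝ, E) N :=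
  (mfderiv 𝓘(ℝ, E) 𝓘(ℝ, E) L.toMulEquiv 1 : E →L[ℝ] E).toLinearMap

/-- The complex eigenvalues of the differential of `L` at the identity, with multiplicity. -/
def eigenvalues [FiniteDimensional ℝ E] (L : LatticeAut E Γ) : Multiset ℂ :=
  L.differential.charpoly.aroots ℂ

/-- `L` is an Anosov automorphism of `N ⧸ Γ`: its differential at the identity is hyperbolic. -/
def IsAnosov [FiniteDimensional ℝ E] (L : LatticeAut E Γ) : Prop :=
  ∀ z ∈ L.eigenvalues, ‖z‖ ≠ 1

/-- `L` has simple spectrum: the moduli of all the eigenvalues, counted with multiplicity, are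
distinct. -/
def HasSimpleSpectrum [FiniteDimensional ℝ E] (L : LatticeAut E Γ) : Prop :=
  (L.eigenvalues.map (‖·‖)).Nodup

end LatticeAut

/-- `γ` is the one-parameter subgroup `t ↦ exp (t X)` of `N`. -/
def IsOneParameterSubgroup (γ : ℝ → N) (X : GroupLieAlgebra 𝓘(ℝ, E) N) : Prop :=
  ContMDiff 𝓘(ℝ, ℝ) 𝓘(ℝ, E) ∞ γ ∧ (∀ s t, γ (s + t) = γ s * γ t) ∧
    mfderiv 𝓘(ℝ, ℝ) 𝓘(ℝ, E) γ 0 (1 : ℝ) = (show E from X)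

/-- The preimage `exp⁻¹(Γ)` in the Lie algebra of the center `Z` of `N`: the vectors `X` such that
`exp (t X) ∈ Z` for all `t` and `exp X ∈ Γ`. -/
def centralLog (E : Type*) [NormedAddCommGroup E] [NormedSpace ℝ E]
    {N : Type*} [TopologicalSpace N] [ChartedSpace E N] [Group N] (Γ : Subgroup N) :
    Set (GroupLieAlgebra 𝓘(ℝ, E) N) :=
  {X | ∃ γ : ℝ → N, IsOneParameterSubgroup γ X ∧ (∀ t, γ t ∈ Subgroup.center N) ∧ γ 1 ∈ Γ}

/-- The Lie algebra of `N` as a vector space over `ℚ`. -/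
instance groupLieAlgebraRatModule : Module ℚ (GroupLieAlgebra 𝓘(ℝ, E) N) :=
  Module.compHom (GroupLieAlgebra 𝓘(ℝ, E) N) (algebraMap ℚ ℝ)

/-- The `ℚ`-structure given by `Γ` on the Lie algebra of the center of `N`: the `ℚ`-span of
`exp⁻¹(Γ)` in it. -/
def centerRationalStructure (E : Type*) [NormedAddCommGroup E] [NormedSpace ℝ E]
    {N : Type*} [TopologicalSpace N] [ChartedSpace E N] [Group N] (Γ : Subgroup N) :
    Submodule ℚ (GroupLieAlgebra 𝓘(ℝ, E) N) :=
  Submodule.span ℚ (centralLog E Γ)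

/-- The restriction of `L` to the center of `N` is reducible over `ℚ` with respect to the
`ℚ`-structure given by `Γ`: the action of the differential of `L` on the rational vectors of the
Lie algebra of the center has an invariant `ℚ`-subspace that is neither zero nor everything. -/
def LatticeAut.IsReducibleOnCenter (L : LatticeAut E Γ) : Prop :=
  ∃ W : Submodule ℚ (GroupLieAlgebra 𝓘(ℝ, E) N),
    W ≠ ⊥ ∧ W < centerRationalStructure E Γ ∧ ∀ X ∈ W, L.differential X ∈ W

end Automorphism

end

/-! Write `A` for the differential of `L` at the identity. Distinct moduli make `A` diagonalizable
over the reals, and its restriction to the rational vectors of the center is semisimple, so a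
rational invariant subspace has a rational invariant complement. Each of the two contains an
expanding eigenvector: a nonzero vector of a discrete invariant subgroup cannot be contracted to
zero. The weaker of these, `v`, has eigenvalue `c` and lies in the real span `S` of one subspace;
the stronger, `w`, has eigenvalue `d` with `1 < |c| < |d|` and lies outside `S`
(`exists_expanding_pair`).

Let `ψ` be a smooth function invariant under `exp S`, and perturb `L` to `g q = exp (ψ q • v) • L
q`. The map `h q = exp (u q • v) • q` satisfies `L ∘ h = h ∘ g` as soon as `c u = ψ + u ∘ L`, which
is solved by the convergent series `u = ∑ c^(-k-1) ψ ∘ L^k` (`mul_conjCocycle`,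
`quotientEquiv_conjMap`).

Periodic data do not change. In frames given by orbit maps the derivative of `g^n` is `A^n + v ⊗ ℓ`
with `ℓ v = 0`, because `ψ` is constant along `v`. Since `c^n` is a simple eigenvalue of `A^n`, this
operator is conjugate to `A^n` (`exists_conj_pow_add_smulRight`, `samePeriodicData_perturb`).

Yet `h` need not be differentiable at the base point `o`. Suppose `ψ` vanishes at `exp (d^(-k) t₀ w)
• o` for all `k ≥ 1`. Then `u` there equals `c^(-k)` times its value at parameter `t₀`, so points at
distance of order `d^(-k)` from `o` are displaced along `v` by order `c^(-k)`, which is much larger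
(`not_hasModelDeriv_conjMap`). The value at `t₀` is nonzero if `|ψ|` is maximal there and `ψ`
vanishes on enough forward iterates. Since `S` is rational, its orbits are compact, so an invariant
`ψ` with these prescribed values exists once the points lie in suitably different orbits; as `w ∉
S`, a generic `t₀` achieves this (`exists_contMDiff_separating_orbit`). Scaling `ψ` by a small `ε ≠
0` puts `g` into any given `C^1` neighbourhood. -/

noncomputable section

/-! ## Derivatives of maps between manifolds, as maps between the model spaces -/

section HasModelDeriv

variable {E : Type*} [NormedAddCommGroup E] [NormedSpace ℝ E]
  {M : Type*} [TopologicalSpace M] [ChartedSpace E M]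
  {E' : Type*} [NormedAddCommGroup E'] [NormedSpace ℝ E']
  {M' : Type*} [TopologicalSpace M'] [ChartedSpace E' M']
  {E'' : Type*} [NormedAddCommGroup E''] [NormedSpace ℝ E'']
  {M'' : Type*} [TopologicalSpace M''] [ChartedSpace E'' M'']

/-- `f` has derivative `A` at `x`, the tangent spaces being identified with the model spaces. -/
def HasModelDeriv (f : M → M') (x : M) (A : E →L[ℝ] E') : Prop :=
  HasMFDerivAt 𝓘(ℝ, E) 𝓘(ℝ, E') f x A

/-- The derivative of `f` at `x`, the tangent spaces being identified with the model spaces. -/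
def modelDeriv (f : M → M') (x : M) : E →L[ℝ] E' :=
  mfderiv 𝓘(ℝ, E) 𝓘(ℝ, E') f x

theorem HasModelDeriv.comp {g : M' → M''} {f : M → M'} {x : M} {y : M'} {B : E' →L[ℝ] E''}
    {A : E →L[ℝ] E'} (hg : HasModelDeriv g y B) (hf : HasModelDeriv f x A) (hy : f x = y) :
    HasModelDeriv (fun z ↦ g (f z)) x (B.comp A) := by
  subst hy
  exact HasMFDerivAt.comp (I' := 𝓘(ℝ, E')) (E' := E') x hg hf

theorem HasModelDeriv.unique {f : M → M'} {x : M} {A B : E →L[ℝ] E'}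
    (hA : HasModelDeriv f x A) (hB : HasModelDeriv f x B) : A = B :=
  hasMFDerivAt_unique hA hB

theorem HasModelDeriv.modelDeriv_eq {f : M → M'} {x : M} {A : E →L[ℝ] E'}
    (hA : HasModelDeriv f x A) : modelDeriv f x = A :=
  HasMFDerivAt.mfderiv hA

theorem HasModelDeriv.congr {f g : M → M'} {x : M} {A : E →L[ℝ] E'}
    (hA : HasModelDeriv f x A) (h : g =ᶠ[𝓝 x] f) : HasModelDeriv g x A :=
  HasMFDerivAt.congr_of_eventuallyEq hA h

theorem ContMDiffAt.hasModelDeriv {n : ℕ∞ω} {f : M → M'} {x : M}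
    (hf : ContMDiffAt 𝓘(ℝ, E) 𝓘(ℝ, E') n f x) (hn : n ≠ 0) :
    HasModelDeriv f x (modelDeriv f x : E →L[ℝ] E') :=
  (hf.mdifferentiableAt hn).hasMFDerivAt

theorem hasModelDeriv_id (x : M) : HasModelDeriv (fun y : M ↦ y) x (ContinuousLinearMap.id ℝ E) :=
  hasMFDerivAt_id x

theorem hasModelDeriv_iff_hasFDerivAt {f : E → E'} {x : E} {A : E →L[ℝ] E'} :
    HasModelDeriv f x A ↔ HasFDerivAt f A x :=
  hasMFDerivAt_iff_hasFDerivAt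

/-- At `(1, 1)` the partial maps of multiplication are `z * 1` and `1 * z`, both the identity, so
its differential is addition. Both values must be `1`: elsewhere the translations would enter. -/
theorem HasModelDeriv.mul_of_eq_one {N : Type*} [TopologicalSpace N] [ChartedSpace E' N] [Group N]
    [LieGroup 𝓘(ℝ, E') ∞ N] {f g : M → N} {x : M} {A B : E →L[ℝ] E'}
    (hf : HasModelDeriv f x A) (hg : HasModelDeriv g x B) (hfx : f x = 1) (hgx : g x = 1) :
    HasModelDeriv (fun y ↦ f y * g y) x (A + B) := by
  have hmul : HasMFDerivAt (𝓘(ℝ, E').prod 𝓘(ℝ, E')) 𝓘(ℝ, E') (fun p : N × N ↦ p.1 * p.2) (f x, g x)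
      (ContinuousLinearMap.fst ℝ E' E' + ContinuousLinearMap.snd ℝ E' E' : E' × E' →L[ℝ] E') := by
    rw [hfx, hgx]
    have h : MDifferentiableAt (𝓘(ℝ, E').prod 𝓘(ℝ, E')) 𝓘(ℝ, E') (fun p : N × N ↦ p.1 * p.2)
        ((1 : N), (1 : N)) := (contMDiff_mul 𝓘(ℝ, E') ∞).mdifferentiableAt (by simp)
    have heq : (ContinuousLinearMap.fst ℝ E' E' + ContinuousLinearMap.snd ℝ E' E' :
        E' × E' →L[ℝ] E') = (mfderiv (𝓘(ℝ, E').prod 𝓘(ℝ, E')) 𝓘(ℝ, E')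
        (fun p : N × N ↦ p.1 * p.2) ((1 : N), (1 : N)) : E' × E' →L[ℝ] E') := by
      refine ContinuousLinearMap.ext fun v ↦ ?_
      have h1 : HasModelDeriv (fun z : N ↦ z * 1) 1 (ContinuousLinearMap.id ℝ E') := by
        simpa only [mul_one] using hasModelDeriv_id (E := E') (1 : N)
      have h2 : HasModelDeriv (fun z : N ↦ 1 * z) 1 (ContinuousLinearMap.id ℝ E') := by
        simpa only [one_mul] using hasModelDeriv_id (E := E') (1 : N)
      refine Eq.trans ?_ (mfderiv_prod_eq_add_apply (v := v) h).symm
      exact congrArg₂ (fun (A B : E' →L[ℝ] E') ↦ A v.1 + B v.2) h1.modelDeriv_eq.symm h2.modelDeriv_eq.symm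
    rw [heq]
    exact h.hasMFDerivAt
  exact HasMFDerivAt.comp x hmul (hf.prodMk hg)

end HasModelDeriv

/-! ## One-parameter subgroups of the center -/

section CentralFlow

variable {E : Type*} [NormedAddCommGroup E] [NormedSpace ℝ E]
  {N : Type*} [TopologicalSpace N] [ChartedSpace E N] [Group N]

/-- `γ` is a smooth one-parameter subgroup of the center of `N` with velocity `X`. -/
structure IsCentralFlow (γ : ℝ → N) (X : E) : Prop where
  contMDiff : ContMDiff 𝓘(ℝ, ℝ) 𝓘(ℝ, E) ∞ γ
  map_add : ∀ s t, γ (s + t) = γ s * γ t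
  hasModelDeriv : HasModelDeriv γ 0 (ContinuousLinearMap.toSpanSingleton ℝ X)
  mem_center : ∀ t, γ t ∈ Subgroup.center N

namespace IsCentralFlow

theorem map_zero {γ : ℝ → N} {X : E} (h : IsCentralFlow γ X) : γ 0 = 1 := by
  have := h.map_add 0 0
  simpa using this

theorem of_isOneParameterSubgroup {γ : ℝ → N} {X : E}
    (h : IsOneParameterSubgroup (E := E) γ X) (hc : ∀ t, γ t ∈ Subgroup.center N) :
    IsCentralFlow γ X := by
  refine ⟨h.1, h.2.1, ?_, hc⟩
  have heq : ContinuousLinearMap.toSpanSingleton ℝ X =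
      (modelDeriv γ (0 : ℝ) : ℝ →L[ℝ] E) := by
    refine ContinuousLinearMap.ext_ring ?_
    rw [ContinuousLinearMap.toSpanSingleton_apply, one_smul]
    exact h.2.2.symm
  rw [heq]
  exact (h.1 0).hasModelDeriv (by simp)

theorem isOneParameterSubgroup {γ : ℝ → N} {X : E} (h : IsCentralFlow γ X) :
    IsOneParameterSubgroup (E := E) γ X := by
  refine ⟨h.contMDiff, h.map_add, ?_⟩
  have := congrArg (fun A : ℝ →L[ℝ] E ↦ A 1) h.hasModelDeriv.modelDeriv_eq
  simp only [ContinuousLinearMap.toSpanSingleton_apply, one_smul] at this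
  exact this

theorem comp_mul {γ : ℝ → N} {X : E} (hγ : IsCentralFlow γ X) (c : ℝ) :
    IsCentralFlow (fun t ↦ γ (c * t)) (c • X) := by
  have h1 : ContDiff ℝ ∞ (fun t : ℝ ↦ c * t) := by fun_prop
  refine ⟨hγ.contMDiff.comp h1.contMDiff, fun s t ↦ by rw [mul_add, hγ.map_add], ?_,
    fun t ↦ hγ.mem_center _⟩
  have h2 : HasModelDeriv (fun t : ℝ ↦ c * t) (0 : ℝ) (c • ContinuousLinearMap.id ℝ ℝ) := by
    rw [hasModelDeriv_iff_hasFDerivAt]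
    exact (hasFDerivAt_id _).const_smul c
  convert hγ.hasModelDeriv.comp h2 (by simp) using 1
  ext; simp

theorem one : IsCentralFlow (fun _ : ℝ ↦ (1 : N)) (0 : E) := by
  refine ⟨contMDiff_const, fun _ _ ↦ by simp, ?_, fun _ ↦ one_mem _⟩
  have heq : ContinuousLinearMap.toSpanSingleton ℝ (0 : E) = 0 := by ext; simp
  rw [heq]
  exact hasMFDerivAt_const (I := 𝓘(ℝ, ℝ)) (I' := 𝓘(ℝ, E)) (1 : N) (0 : ℝ)

variable [LieGroup 𝓘(ℝ, E) ∞ N]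

theorem mul {γ δ : ℝ → N} {X Y : E} (hγ : IsCentralFlow γ X) (hδ : IsCentralFlow δ Y) :
    IsCentralFlow (fun t ↦ γ t * δ t) (X + Y) := by
  refine ⟨hγ.contMDiff.mul hδ.contMDiff, fun s t ↦ ?_, ?_,
    fun t ↦ mul_mem (hγ.mem_center t) (hδ.mem_center t)⟩
  · rw [hγ.map_add, hδ.map_add, mul_assoc, mul_assoc]
    congr 1
    rw [← mul_assoc, ← mul_assoc, Subgroup.mem_center_iff.1 (hδ.mem_center s) (γ t)]
  · convert hγ.hasModelDeriv.mul_of_eq_one hδ.hasModelDeriv hγ.map_zero hδ.map_zero using 1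
    ext; simp

/-- Writing `γ s = γ (s - t) * γ t` carries the vanishing derivative at `0` to every `t`. So `γ` is
constant in a chart near `0`, and every `γ t` is a power of a value near `0`. -/
theorem eq_one [T2Space N] {γ : ℝ → N} (h : IsCentralFlow γ (0 : E)) (t : ℝ) : γ t = 1 := by
  have hd : ∀ t, HasModelDeriv (E' := E) γ t (0 : ℝ →L[ℝ] E) := by
    intro t
    have h1 : HasModelDeriv (fun s : ℝ ↦ s - t) t (ContinuousLinearMap.id ℝ ℝ) := by
      rw [hasModelDeriv_iff_hasFDerivAt]
      exact (hasFDerivAt_id t).sub_const t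
    have h2 : HasModelDeriv γ 0 (0 : ℝ →L[ℝ] E) := by
      convert h.hasModelDeriv using 1
      ext; simp
    have hR : ContMDiff 𝓘(ℝ, E) 𝓘(ℝ, E) ∞ (fun y : N ↦ y * γ t) := contMDiff_mul_right
    have h3 := (hR 1).hasModelDeriv (by simp)
    have h4 := (h3.comp h2 h.map_zero).comp h1 (sub_self t)
    have h5 : (fun s ↦ γ s) = fun s ↦ γ (s - t) * γ t := by
      ext s
      rw [← h.map_add, sub_add_cancel]
    convert h4 using 1
    ext; simp
  have hsrc : ∀ᶠ s in 𝓝 (0 : ℝ), γ s ∈ (chartAt E (1 : N)).source := by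
    have hc : ContinuousAt γ 0 := h.contMDiff.continuous.continuousAt
    refine hc ((chartAt E (1 : N)).open_source.mem_nhds ?_)
    rw [h.map_zero]
    exact mem_chart_source E _
  obtain ⟨r, hr, hball⟩ := Metric.eventually_nhds_iff_ball.1 hsrc
  have hzero : ∀ s ∈ Metric.ball (0 : ℝ) r, γ s = 1 := by
    intro s hs
    have hconst : chartAt E (1 : N) (γ s) = chartAt E (1 : N) (γ 0) := by
      refine (convex_ball (0 : ℝ) r).is_const_of_fderivWithin_eq_zero (𝕜 := ℝ)
        (f := fun s ↦ chartAt E (1 : N) (γ s)) ?_ ?_ hs (Metric.mem_ball_self hr)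
      all_goals
        intro x hx
        have h1 : ContMDiffAt 𝓘(ℝ, E) 𝓘(ℝ, E) ∞ (chartAt E (1 : N)) (γ x) :=
          (contMDiffOn_chart (n := ∞)).contMDiffAt
            ((chartAt E (1 : N)).open_source.mem_nhds (hball x hx))
        have h2 := (h1.hasModelDeriv (by simp)).comp (hd x) rfl
        rw [hasModelDeriv_iff_hasFDerivAt] at h2
      · exact h2.differentiableAt.differentiableWithinAt
      · rw [(h2.hasFDerivWithinAt).fderivWithin (Metric.isOpen_ball.uniqueDiffWithinAt hx)]
        simp
    have := (chartAt E (1 : N)).injOn (hball s hs) (hball 0 (Metric.mem_ball_self hr)) hconst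
    rw [this, h.map_zero]
  have hpow : ∀ (n : ℕ) (s : ℝ), γ (n * s) = γ s ^ n := by
    intro n s
    induction n with
    | zero => simp [h.map_zero]
    | succ n ih => rw [Nat.cast_succ, add_mul, one_mul, h.map_add, ih, pow_succ]
  obtain ⟨n, hn⟩ := exists_nat_gt (|t| / r)
  have hn0 : (0 : ℝ) < n := lt_of_le_of_lt (by positivity) hn
  have : γ (n * (t / n)) = γ t := by congr 1; field_simp
  rw [← this, hpow, hzero, one_pow]
  rw [mem_ball_zero_iff, Real.norm_eq_abs, abs_div, abs_of_pos hn0, div_lt_iff₀ hn0]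
  rwa [div_lt_iff₀ hr, mul_comm] at hn

/-- By centrality `t ↦ γ t * δ (-t)` is again a one-parameter subgroup; its velocity is zero. -/
theorem unique [T2Space N] {γ δ : ℝ → N} {X : E} (hγ : IsCentralFlow γ X)
    (hδ : IsCentralFlow δ X) : γ = δ := by
  ext t
  have h := hγ.mul (hδ.comp_mul (-1))
  rw [neg_one_smul, add_neg_cancel] at h
  have h1 : γ t * δ (-1 * t) = 1 := h.eq_one t
  have h2 : δ t * δ (-1 * t) = 1 := by
    rw [← hδ.map_add, ← hδ.map_zero]; congr 1; ring
  exact mul_right_cancel (h1.trans h2.symm)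

end IsCentralFlow

end CentralFlow

/-! ## The exponential map of the center -/

section CentralExp

variable (E : Type*) [NormedAddCommGroup E] [NormedSpace ℝ E]
  (N : Type*) [TopologicalSpace N] [ChartedSpace E N] [Group N]
  [LieGroup 𝓘(ℝ, E) ∞ N]

/-- The Lie algebra of the center of `N`: the velocities of its one-parameter subgroups. -/
def centralLie : Submodule ℝ E where
  carrier := {X | ∃ γ : ℝ → N, IsCentralFlow γ X}
  add_mem' := by
    rintro X Y ⟨γ, hγ⟩ ⟨δ, hδ⟩
    exact ⟨_, hγ.mul hδ⟩
  zero_mem' := ⟨_, IsCentralFlow.one⟩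
  smul_mem' := by
    rintro c X ⟨γ, hγ⟩
    exact ⟨_, hγ.comp_mul c⟩

variable {E N}

/-- The exponential map of the center of `N`. -/
def centralExp (X : centralLie E N) : N := X.2.choose 1

theorem IsCentralFlow.mem_centralLie {γ : ℝ → N} {X : E} (hγ : IsCentralFlow γ X) :
    X ∈ centralLie E N := ⟨γ, hγ⟩

variable [T2Space N]

theorem IsCentralFlow.centralExp_eq {γ : ℝ → N} {X : centralLie E N}
    (hγ : IsCentralFlow γ (X : E)) : centralExp X = γ 1 := by
  rw [centralExp, X.2.choose_spec.unique hγ]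

theorem IsCentralFlow.centralExp_smul_eq {γ : ℝ → N} {X : centralLie E N}
    (hγ : IsCentralFlow γ (X : E)) (t : ℝ) : centralExp (t • X) = γ t := by
  rw [IsCentralFlow.centralExp_eq (X := t • X) (hγ.comp_mul t), mul_one]

theorem isCentralFlow_centralExp (X : centralLie E N) :
    IsCentralFlow (fun t : ℝ ↦ centralExp (t • X)) (X : E) := by
  obtain ⟨γ, hγ⟩ := X.2
  have : (fun t : ℝ ↦ centralExp (t • X)) = γ := funext fun t ↦ hγ.centralExp_smul_eq t
  rwa [this]

theorem centralExp_add (X Y : centralLie E N) :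
    centralExp (X + Y) = centralExp X * centralExp Y := by
  have h := (isCentralFlow_centralExp X).mul (isCentralFlow_centralExp Y)
  rw [IsCentralFlow.centralExp_eq (X := X + Y) h, one_smul, one_smul]

@[simp]
theorem centralExp_zero : centralExp (0 : centralLie E N) = 1 := by
  have := centralExp_add (0 : centralLie E N) 0
  simpa using this

theorem centralExp_neg (X : centralLie E N) : centralExp (-X) = (centralExp X)⁻¹ := by
  rw [eq_inv_iff_mul_eq_one, ← centralExp_add, neg_add_cancel, centralExp_zero]

theorem centralExp_mem_center (X : centralLie E N) : centralExp X ∈ Subgroup.center N := by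
  have := (isCentralFlow_centralExp X).mem_center 1
  rwa [one_smul] at this

theorem centralExp_mul_comm (X : centralLie E N) (y : N) :
    centralExp X * y = y * centralExp X :=
  (Subgroup.mem_center_iff.1 (centralExp_mem_center X) y).symm

variable [FiniteDimensional ℝ E]

/-- In a basis, the exponential of a sum is a product of smooth one-parameter subgroups evaluated at
the coordinates. Commutativity thus replaces smooth dependence of flows on parameters. -/
theorem contMDiff_centralExp :
    ContMDiff 𝓘(ℝ, centralLie E N) 𝓘(ℝ, E) ∞ (centralExp : centralLie E N → N) := by
  let b := Module.finBasis ℝ (centralLie E N)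
  have key : ∀ s : Finset (Fin (Module.finrank ℝ (centralLie E N))),
      ContMDiff 𝓘(ℝ, centralLie E N) 𝓘(ℝ, E) ∞
        (fun X : centralLie E N ↦ centralExp (∑ i ∈ s, b.repr X i • b i)) := by
    intro s
    induction s using Finset.induction_on with
    | empty => simpa using contMDiff_const
    | insert i s hi ih =>
      simp only [Finset.sum_insert hi, centralExp_add]
      refine ContMDiff.mul ?_ ih
      have h : ContDiff ℝ ∞ (fun X : centralLie E N ↦ b.repr X i) :=
        (LinearMap.toContinuousLinearMap (b.coord i)).contDiff
      exact (isCentralFlow_centralExp (b i)).contMDiff.comp h.contMDiff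
  have := key Finset.univ
  simpa only [b.sum_repr] using this

theorem hasModelDeriv_centralExp :
    HasModelDeriv (centralExp : centralLie E N → N) 0 (centralLie E N).subtypeL := by
  have h := (contMDiff_centralExp (E := E) (N := N) 0).hasModelDeriv (by simp)
  convert h using 1
  ext X
  have h1 : HasModelDeriv (fun t : ℝ ↦ t • X) (0 : ℝ) (ContinuousLinearMap.toSpanSingleton ℝ X) := by
    rw [hasModelDeriv_iff_hasFDerivAt]
    exact (ContinuousLinearMap.toSpanSingleton ℝ X).hasFDerivAt
  have h2 := (h.comp h1 (zero_smul ℝ X)).unique (isCentralFlow_centralExp X).hasModelDeriv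
  have := congrArg (fun A : ℝ →L[ℝ] E ↦ A 1) h2
  simpa using this.symm

end CentralExp

/-! ### Maps with injective derivative, read in charts. -/

section Chart

variable {E : Type*} [NormedAddCommGroup E] [NormedSpace ℝ E]
  {M : Type*} [TopologicalSpace M] [ChartedSpace E M]

theorem HasModelDeriv.hasFDerivAt_chart {F : Type*} [NormedAddCommGroup F] [NormedSpace ℝ F]
    {f : F → M} {x : F} {A : F →L[ℝ] E} (hf : HasModelDeriv f x A) :
    HasFDerivAt (fun y ↦ chartAt E (f x) (f y)) A x := by
  refine hasFDerivWithinAt_univ.1 ?_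
  have := hf.2
  simp only [writtenInExtChartAt, extChartAt, mfld_simps] at this
  exact this

/-- Near a point where the derivative of `f` is injective, `y - x` is controlled by the variation
of `f` in charts. -/
theorem HasModelDeriv.isBigO_sub_rev {F : Type*} [NormedAddCommGroup F] [NormedSpace ℝ F]
    [FiniteDimensional ℝ F] {f : F → M} {x : F} {A : F →L[ℝ] E} (hf : HasModelDeriv f x A)
    (hA : Injective A) :
    (fun y ↦ y - x) =O[𝓝 x] fun y ↦ chartAt E (f x) (f y) - chartAt E (f x) (f x) := by
  obtain ⟨K, -, hK⟩ := (LinearMap.injective_iff_antilipschitz (A : F →ₗ[ℝ] E)).1 hA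
  have h := hf.hasFDerivAt_chart
  have hAO : (fun y ↦ y - x) =O[𝓝 x] fun y ↦ A (y - x) := by
    refine Asymptotics.IsBigO.of_bound K (Eventually.of_forall fun y ↦ ?_)
    have := hK.le_mul_dist (y - x) 0
    simpa using this
  refine hAO.trans ((h.isLittleO.trans_isBigO hAO).right_isBigO_add.congr_right fun y ↦ ?_)
  simp

end Chart

/-! ## The action of an automorphism and the lattice in the center -/

section CentralLattice

variable {E : Type*} [NormedAddCommGroup E] [NormedSpace ℝ E]
  {N : Type*} [TopologicalSpace N] [ChartedSpace E N] [Group N]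
  {Γ : Subgroup N}

namespace LatticeAut

/-- The differential of `L` at the identity as a continuous linear map of the model space. -/
def modelDifferential (L : LatticeAut E Γ) : E →L[ℝ] E := modelDeriv L.toMulEquiv 1

theorem hasModelDeriv (L : LatticeAut E Γ) : HasModelDeriv L.toMulEquiv 1 L.modelDifferential :=
  (L.contMDiff_toFun 1).hasModelDeriv (by simp)

theorem isCentralFlow_comp (L : LatticeAut E Γ) {γ : ℝ → N} {X : E} (hγ : IsCentralFlow γ X) :
    IsCentralFlow (fun t ↦ L.toMulEquiv (γ t)) (L.modelDifferential X) := by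
  refine ⟨L.contMDiff_toFun.comp hγ.contMDiff, fun s t ↦ by rw [hγ.map_add, map_mul], ?_,
    fun t ↦ ?_⟩
  · convert L.hasModelDeriv.comp hγ.hasModelDeriv hγ.map_zero using 1
    ext; simp
  · rw [Subgroup.mem_center_iff]
    intro y
    obtain ⟨z, rfl⟩ := L.toMulEquiv.surjective y
    rw [← map_mul, ← map_mul, Subgroup.mem_center_iff.1 (hγ.mem_center t)]

variable [LieGroup 𝓘(ℝ, E) ∞ N]

/-- The action of `L` on the Lie algebra of the center. -/
def centralMap (L : LatticeAut E Γ) : centralLie E N →ₗ[ℝ] centralLie E N :=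
  (L.modelDifferential : E →ₗ[ℝ] E).restrict fun _ ⟨_, hγ⟩ ↦ ⟨_, L.isCentralFlow_comp hγ⟩

@[simp]
theorem coe_centralMap (L : LatticeAut E Γ) (X : centralLie E N) :
    (L.centralMap X : E) = L.modelDifferential X := rfl

theorem centralExp_centralMap [T2Space N] (L : LatticeAut E Γ) (X : centralLie E N) :
    centralExp (L.centralMap X) = L.toMulEquiv (centralExp X) := by
  rw [IsCentralFlow.centralExp_eq (X := L.centralMap X)
    (L.isCentralFlow_comp (isCentralFlow_centralExp X)), one_smul]

end LatticeAut

variable [LieGroup 𝓘(ℝ, E) ∞ N] [T2Space N]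

/-- The logarithms of the elements of `Γ` in the Lie algebra of the center. -/
def centralLattice (E : Type*) [NormedAddCommGroup E] [NormedSpace ℝ E]
    {N : Type*} [TopologicalSpace N] [ChartedSpace E N] [Group N]
    [LieGroup 𝓘(ℝ, E) ∞ N] [T2Space N] (Γ : Subgroup N) : Submodule ℤ E :=
  AddSubgroup.toIntSubmodule
    { carrier := {X | ∃ h : X ∈ centralLie E N, centralExp ⟨X, h⟩ ∈ Γ}
      add_mem' := by
        rintro X Y ⟨hX, hX'⟩ ⟨hY, hY'⟩
        refine ⟨add_mem hX hY, ?_⟩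
        have := centralExp_add (⟨X, hX⟩ : centralLie E N) ⟨Y, hY⟩
        exact this ▸ mul_mem hX' hY'
      zero_mem' := ⟨zero_mem _, by
        have := centralExp_zero (E := E) (N := N)
        exact this ▸ one_mem Γ⟩
      neg_mem' := by
        rintro X ⟨hX, hX'⟩
        refine ⟨neg_mem hX, ?_⟩
        have := centralExp_neg (⟨X, hX⟩ : centralLie E N)
        exact this ▸ inv_mem hX' }

theorem mem_centralLattice {X : E} :
    X ∈ centralLattice E Γ ↔ ∃ h : X ∈ centralLie E N, centralExp ⟨X, h⟩ ∈ Γ :=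
  Iff.rfl

theorem LatticeAut.modelDifferential_mem (L : LatticeAut E Γ) {X : E}
    (hX : X ∈ centralLattice E Γ) : L.modelDifferential X ∈ centralLattice E Γ := by
  obtain ⟨h, hX⟩ := hX
  refine ⟨(L.centralMap ⟨X, h⟩).2, ?_⟩
  have := L.centralExp_centralMap ⟨X, h⟩
  exact this ▸ (L.mem_iff _).2 hX

/-- Identifies the set in the statement with a subgroup, so that lattice arguments apply to its
rational span. -/
theorem coe_centralLattice :
    (centralLattice E Γ : Set E) = (centralLog E Γ : Set E) := by
  ext X
  constructor
  · rintro ⟨h, hX⟩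
    have h' := isCentralFlow_centralExp ⟨X, h⟩
    refine ⟨_, h'.isOneParameterSubgroup, h'.mem_center, ?_⟩
    rw [one_smul]
    exact hX
  · rintro ⟨γ, h1, h2, h3⟩
    have h := IsCentralFlow.of_isOneParameterSubgroup h1 h2
    refine ⟨h.mem_centralLie, ?_⟩
    rw [IsCentralFlow.centralExp_eq (by exact h)]
    exact h3

variable [FiniteDimensional ℝ E]

/-- Near `0` the exponential takes the value `1` only at `0`, its derivative there being injective;
and `1` is isolated in `Γ`. -/
theorem eventually_centralExp_mem [DiscreteTopology Γ] :
    ∀ᶠ X : centralLie E N in 𝓝 0, centralExp X ∈ Γ → X = 0 := by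
  have hO := hasModelDeriv_centralExp (E := E) (N := N).isBigO_sub_rev
    (Subtype.val_injective)
  obtain ⟨C, hC⟩ := hO.bound
  obtain ⟨U, hU, hUΓ⟩ := (discreteTopology_subtype_iff' (Y := N) (S := (Γ : Set N))).1
    inferInstance 1 (one_mem Γ)
  have hcont : ContinuousAt (centralExp : centralLie E N → N) 0 :=
    contMDiff_centralExp.continuous.continuousAt
  have h1 : U ∈ 𝓝 (centralExp (0 : centralLie E N)) := by
    rw [centralExp_zero]
    refine hU.mem_nhds ?_
    have : (1 : N) ∈ U ∩ Γ := by rw [hUΓ]; rfl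
    exact this.1
  filter_upwards [hC, hcont h1] with X hX hXU hXΓ
  have : centralExp X = 1 := by
    have : centralExp X ∈ U ∩ Γ := ⟨hXU, hXΓ⟩
    rwa [hUΓ] at this
  rw [this, centralExp_zero, sub_self, norm_zero, mul_zero, sub_zero] at hX
  exact norm_le_zero_iff.1 hX

theorem eventually_mem_centralLattice [DiscreteTopology Γ] :
    ∀ᶠ X : E in 𝓝 0, X ∈ centralLattice E Γ → X = 0 := by
  have h := eventually_centralExp_mem (E := E) (Γ := Γ)
  rw [nhds_subtype_eq_comap, eventually_comap] at h
  filter_upwards [h] with X hX ⟨hX1, hX2⟩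
  exact congrArg Subtype.val (hX ⟨X, hX1⟩ rfl hX2)

end CentralLattice

/-! ## Linear algebra -/

section LinearAlgebra

open Module Polynomial

variable {E : Type*} [NormedAddCommGroup E] [NormedSpace ℝ E]

/-- A real endomorphism whose complex eigenvalues have distinct moduli is diagonalizable. -/
theorem exists_eigenbasis_of_nodup_norm [FiniteDimensional ℝ E] (A : E →ₗ[ℝ] E)
    (h : ((A.charpoly.aroots ℂ).map (‖·‖)).Nodup) :
    ∃ (ι : Type) (_ : Fintype ι) (b : Basis ι ℝ E) (l : ι → ℝ), (∀ i, A (b i) = l i • b i) ∧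
      Injective (fun i ↦ |l i|) ∧ ∀ i, (l i : ℂ) ∈ A.charpoly.aroots ℂ := by
  classical
  set R := A.charpoly.aroots ℂ with hR
  have hp0 : A.charpoly ≠ 0 := A.charpoly_monic.ne_zero
  have hnd : R.Nodup := Multiset.Nodup.of_map _ h
  have hinj : ∀ z ∈ R, ∀ w ∈ R, ‖z‖ = ‖w‖ → z = w := Multiset.inj_on_of_nodup_map h
  -- The conjugate of a root is a root of the same modulus, hence the same root.
  have hreal : ∀ z ∈ R, ((z.re : ℝ) : ℂ) = z := by
    intro z hz
    have hz' : (starRingEnd ℂ) z ∈ R := by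
      rw [hR, mem_aroots] at hz ⊢
      refine ⟨hp0, ?_⟩
      have := Polynomial.aeval_conj A.charpoly z
      rw [this, hz.2, map_zero]
    exact Complex.conj_eq_iff_re.1 (hinj _ hz' _ hz (by simp))
  have hcard : R.toFinset.card = finrank ℝ E := by
    rw [Multiset.toFinset_card_of_nodup hnd, hR, aroots_def, ← A.charpoly_natDegree]
    rw [← natDegree_map (algebraMap ℝ ℂ)]
    exact (splits_iff_card_roots.1 (IsAlgClosed.splits _))
  let ι := {z : ℂ // z ∈ R.toFinset}
  have hmem : ∀ i : ι, (i : ℂ) ∈ R := fun i ↦ Multiset.mem_toFinset.1 i.2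
  have heig : ∀ i : ι, ∃ v : E, End.HasEigenvector A (i : ℂ).re v := by
    intro i
    have h1 : (((i : ℂ).re : ℝ) : ℂ) ∈ R := (hreal _ (hmem i)).symm ▸ hmem i
    have h2 : A.charpoly.IsRoot (i : ℂ).re := by
      have := (mem_aroots.1 h1).2
      rw [← Complex.coe_algebraMap, aeval_algebraMap_apply] at this
      simpa using this
    exact ((End.hasEigenvalue_iff_isRoot_charpoly A _).2 h2).exists_hasEigenvector
  choose v hv using heig
  have hlinj : Injective (fun i : ι ↦ |(i : ℂ).re|) := by
    intro i j hij
    refine Subtype.ext (hinj _ (hmem i) _ (hmem j) ?_)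
    rw [← hreal _ (hmem i), ← hreal _ (hmem j)]
    simpa using hij
  have hli : LinearIndependent ℝ v := End.eigenvectors_linearIndependent' A
    (fun i : ι ↦ (i : ℂ).re) (fun i j hij ↦ hlinj (congrArg abs hij)) v hv
  refine ⟨ι, inferInstance, basisOfLinearIndependentOfCardEqFinrank' v hli ?_, fun i ↦ (i : ℂ).re,
    fun i ↦ ?_, hlinj, fun i ↦ ?_⟩
  · rw [← hcard]; exact Fintype.card_coe _
  · simpa using (hv i).apply_eq_smul
  · rw [hreal _ (hmem i)]
    exact hmem i

/-! ### Operators with an eigenbasis: invariant subspaces and discrete invariant subgroups. -/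

section Eigenbasis

variable {ι : Type*} {A : E →ₗ[ℝ] E} {b : Basis ι ℝ E} {l : ι → ℝ}

theorem pow_apply_eigenbasis (hA : ∀ i, A (b i) = l i • b i) (n : ℕ) (i : ι) :
    (A ^ n) (b i) = l i ^ n • b i := by
  induction n with
  | zero => simp
  | succ n ih => rw [pow_succ', Module.End.mul_apply, ih, map_smul, hA, smul_smul, pow_succ]

/-- If `v` is an eigenvector of `A`, a simple eigenvalue of `A ^ n`, and `ℓ v = 0`, then
`A ^ n + v ⊗ ℓ` is conjugate to `A ^ n`. -/
theorem exists_conj_pow_add_smulRight (hA : ∀ i, A (b i) = l i • b i)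
    (hl : Injective (fun i ↦ |l i|)) (i₀ : ι) (ℓ : E →ₗ[ℝ] ℝ) (hℓ : ℓ (b i₀) = 0) {n : ℕ}
    (hn : 0 < n) :
    ∃ P : E ≃ₗ[ℝ] E, ∀ x, P ((A ^ n) x + ℓ x • b i₀) = (A ^ n) (P x) := by
  classical
  -- `m` solves `m ∘ A^n + ℓ = (l i₀)^n m`, the condition for `1 + m ⊗ b i₀` to conjugate. At `i₀`
  -- the quotient is `0 / 0 = 0`, which is consistent because `ℓ (b i₀) = 0`.
  let m : E →ₗ[ℝ] ℝ := b.constr ℝ fun i ↦ ℓ (b i) / (l i₀ ^ n - l i ^ n)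
  have hm : ∀ i, m (b i) = ℓ (b i) / (l i₀ ^ n - l i ^ n) := fun i ↦ b.constr_basis ℝ _ i
  have hm0 : m (b i₀) = 0 := by rw [hm, hℓ, zero_div]
  -- A transvection: as `m (b i₀) = 0`, changing the sign of `m` inverts it.
  refine ⟨LinearEquiv.ofLinearMap (LinearMap.id + m.smulRight (b i₀))
    (LinearMap.id - m.smulRight (b i₀)) ?_ ?_, ?_⟩
  · ext x; simp [hm0]
  · ext x; simp [hm0]
  intro x
  have key : ∀ x, m ((A ^ n) x) + ℓ x = l i₀ ^ n * m x := by
    intro x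
    have : m ∘ₗ (A ^ n) + ℓ = l i₀ ^ n • m := by
      refine b.ext fun i ↦ ?_
      simp only [LinearMap.add_apply, LinearMap.comp_apply, pow_apply_eigenbasis hA, map_smul,
        LinearMap.smul_apply, smul_eq_mul]
      rcases eq_or_ne i i₀ with rfl | hi
      · simp [hm0, hℓ]
      · have hne : l i₀ ^ n - l i ^ n ≠ 0 := by
          intro h0
          refine hi (hl ?_)
          have : |l i₀| ^ n = |l i| ^ n := by rw [← abs_pow, ← abs_pow, sub_eq_zero.1 h0]
          exact ((pow_left_inj₀ (abs_nonneg _) (abs_nonneg _) hn.ne').1 this).symm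
        rw [hm]
        field_simp
        ring
    simpa using LinearMap.congr_fun this x
  simp only [LinearEquiv.coe_ofLinearMap, LinearMap.add_apply, LinearMap.id_apply,
    LinearMap.smulRight_apply, map_add, map_smul, hm0, pow_apply_eigenbasis hA]
  rw [zero_smul, add_zero, add_assoc, ← add_smul, key, smul_smul, mul_comm]

variable [Fintype ι]

theorem repr_apply_eigenbasis (hA : ∀ i, A (b i) = l i • b i) (x : E) (i : ι) :
    b.repr (A x) i = l i * b.repr x i := by
  classical
  conv_lhs => rw [← b.sum_repr x]
  simp only [map_sum, map_smul, hA, Finsupp.coe_finsetSum, Finset.sum_apply, Finsupp.smul_apply,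
    b.repr_self, Finsupp.single_apply, smul_eq_mul]
  simp [mul_comm]

theorem repr_pow_apply_eigenbasis (hA : ∀ i, A (b i) = l i • b i) (n : ℕ) (x : E) (i : ι) :
    b.repr ((A ^ n) x) i = l i ^ n * b.repr x i := by
  induction n with
  | zero => simp
  | succ n ih => rw [pow_succ', Module.End.mul_apply, repr_apply_eigenbasis hA, ih]; ring

/-- Invariant subspaces contain the eigenvectors occurring in their elements. -/
theorem eigenbasis_mem_of_invariant (hA : ∀ i, A (b i) = l i • b i) (hl : Injective l)
    {S : Submodule ℝ E} (hS : ∀ x ∈ S, A x ∈ S) {x : E} (hx : x ∈ S) {i : ι}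
    (hi : b.repr x i ≠ 0) : b i ∈ S := by
  classical
  -- Apply the product of the operators `A - l j`, `j ∈ s`. Taking all `j ≠ i` leaves only the
  -- `i`-th component, with nonzero coefficient.
  have key : ∀ s : Finset ι, ∑ k, (b.repr x k * ∏ j ∈ s, (l k - l j)) • b k ∈ S := by
    intro s
    induction s using Finset.induction_on with
    | empty => simpa [b.sum_repr] using hx
    | insert j s hj ih =>
      have := S.sub_mem (hS _ ih) (S.smul_mem (l j) ih)
      convert this using 1
      rw [map_sum, Finset.smul_sum, ← Finset.sum_sub_distrib]
      refine Finset.sum_congr rfl fun k _ ↦ ?_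
      rw [Finset.prod_insert hj, map_smul, hA, smul_smul, smul_smul, ← sub_smul]
      congr 1
      ring
  have h := key (Finset.univ.erase i)
  rw [Finset.sum_eq_single i] at h
  · refine (S.smul_mem_iff (mul_ne_zero hi ?_)).1 h
    refine Finset.prod_ne_zero_iff.2 fun j hj ↦ ?_
    rw [sub_ne_zero]
    exact fun hij ↦ (Finset.mem_erase.1 hj).1 (hl hij).symm
  · intro k _ hk
    rw [Finset.prod_eq_zero (i := k) (by simp [hk]) (sub_self _), mul_zero, zero_smul]
  · simp

/-- A nonzero vector of an invariant discrete subgroup has an expanding component. -/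
theorem exists_one_lt_abs_of_mem_discrete (hA : ∀ i, A (b i) = l i • b i)
    (h1 : ∀ i, |l i| ≠ 1) (h0 : ∀ i, l i ≠ 0) {Λ : Submodule ℤ E}
    (hΛ : ∀ᶠ x : E in 𝓝 0, x ∈ Λ → x = 0) (hAΛ : ∀ x ∈ Λ, A x ∈ Λ) {x : E} (hx : x ∈ Λ)
    (hx0 : x ≠ 0) : ∃ i, b.repr x i ≠ 0 ∧ 1 < |l i| := by
  by_contra! hcon
  -- Only contracting components occur, so the orbit tends to `0` inside `Λ`. By discreteness some
  -- `A^n x` is zero, which is impossible as all `l i` are nonzero.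
  have hlim : Tendsto (fun n : ℕ ↦ (A ^ n) x) atTop (𝓝 0) := by
    have hexp : ∀ n : ℕ, (A ^ n) x = ∑ i, (l i ^ n * b.repr x i) • b i := by
      intro n
      rw [← b.sum_repr ((A ^ n) x)]
      simp_rw [repr_pow_apply_eigenbasis hA]
    simp_rw [hexp]
    rw [show (0 : E) = ∑ i : ι, (0 * b.repr x i) • b i by simp]
    refine tendsto_finsetSum _ fun i _ ↦ ?_
    rcases eq_or_ne (b.repr x i) 0 with hi | hi
    · simp [hi]
    · exact ((tendsto_pow_atTop_nhds_zero_of_abs_lt_one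
        (lt_of_le_of_ne (hcon i hi) (h1 i))).mul_const _).smul_const _
  obtain ⟨n, hn⟩ := (hlim.eventually hΛ).exists
  have hmem : ∀ n : ℕ, (A ^ n) x ∈ Λ := by
    intro n
    induction n with
    | zero => simpa
    | succ n ih => rw [pow_succ', Module.End.mul_apply]; exact hAΛ _ ih
  have hz := hn (hmem n)
  refine hx0 (b.ext_elem fun i ↦ ?_)
  have := repr_pow_apply_eigenbasis hA n x i
  rw [hz] at this
  simp only [map_zero, Finsupp.coe_zero, Pi.zero_apply, zero_eq_mul] at this ⊢
  exact this.resolve_left (pow_ne_zero _ (h0 i))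

end Eigenbasis

theorem exists_nsmul_mem_of_mem_span_rat {V : Type*} [AddCommGroup V] [Module ℚ V]
    (Λ : Submodule ℤ V) {x : V} (hx : x ∈ Submodule.span ℚ (Λ : Set V)) :
    ∃ n : ℕ, n ≠ 0 ∧ n • x ∈ Λ := by
  induction hx using Submodule.span_induction with
  | mem x hx => exact ⟨1, one_ne_zero, by simpa using hx⟩
  | zero => exact ⟨1, one_ne_zero, by simp⟩
  | add x y _ _ hx hy =>
    obtain ⟨n, hn, hx⟩ := hx
    obtain ⟨m, hm, hy⟩ := hy
    refine ⟨n * m, mul_ne_zero hn hm, ?_⟩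
    rw [smul_add]
    refine add_mem ?_ ?_
    · rw [mul_comm, mul_smul]; exact nsmul_mem hx m
    · rw [mul_smul]; exact nsmul_mem hy n
  | smul a x _ hx =>
    obtain ⟨n, hn, hx⟩ := hx
    refine ⟨n * a.den, mul_ne_zero hn a.den_nz, ?_⟩
    have : (n * a.den) • a • x = a.num • n • x := by
      rw [← Nat.cast_smul_eq_nsmul ℚ, ← Nat.cast_smul_eq_nsmul ℚ n, ← Int.cast_smul_eq_zsmul ℚ,
        smul_smul, smul_smul]
      congr 1
      push_cast
      rw [mul_assoc, Rat.den_mul_eq_num]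
      ring
    rw [this]
    exact Λ.smul_mem _ hx

theorem finrank_span_real_le [Module ℚ E] [FiniteDimensional ℝ E] (U : Submodule ℚ E)
    [Module.Finite ℚ U] : finrank ℝ (Submodule.span ℝ (U : Set E)) ≤ finrank ℚ U := by
  have : IsScalarTower ℚ ℝ E := inferInstance
  let b := finBasis ℚ U
  have h : Submodule.span ℝ (U : Set E) ≤
      Submodule.span ℝ (range fun i ↦ ((b i : U) : E)) := by
    rw [Submodule.span_le]
    intro x hx
    have h1 := b.sum_repr ⟨x, hx⟩
    have h2 := congrArg (U.subtype) h1
    rw [map_sum] at h2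
    have h3 : U.subtype ⟨x, hx⟩ = x := rfl
    rw [SetLike.mem_coe, ← h3, ← h2]
    refine sum_mem fun i _ ↦ ?_
    rw [map_smul, ← algebraMap_smul ℝ]
    exact Submodule.smul_mem _ _ (Submodule.subset_span ⟨i, rfl⟩)
  calc _ ≤ _ := Submodule.finrank_mono h
    _ ≤ _ := finrank_range_le_card _
    _ = _ := by simp

/-! ### Rational invariant subspaces and the choice of two expanding eigenvectors. -/

section Selection

variable [Module ℚ E] {Λ : Submodule ℤ E}

theorem discreteTopology_of_eventually_eq_zero {E : Type*} [NormedAddCommGroup E]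
    {Λ : Submodule ℤ E} (hΛ : ∀ᶠ x : E in 𝓝 0, x ∈ Λ → x = 0) :
    DiscreteTopology Λ := by
  refine discreteTopology_of_isOpen_singleton_zero ?_
  have h : ∀ᶠ X : Λ in 𝓝 0, X = 0 := by
    have := (continuous_subtype_val.continuousAt (x := (0 : Λ))).eventually hΛ
    filter_upwards [this] with X hX
    exact Subtype.ext (hX X.2)
  rw [isOpen_singleton_iff_nhds_eq_pure]
  exact le_antisymm (le_pure_iff.2 h) (pure_le_nhds _)

/-- An integral basis of `Λ` spans over `ℚ`, and discreteness makes its cardinality the dimension of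
the real span. Rationally independent vectors in the span therefore cannot outnumber the real
dimension. -/
theorem finite_span_rat_of_discrete [FiniteDimensional ℝ E]
    (hΛ : ∀ᶠ x : E in 𝓝 0, x ∈ Λ → x = 0) :
    Module.Finite ℚ (Submodule.span ℚ (Λ : Set E)) ∧
      finrank ℚ (Submodule.span ℚ (Λ : Set E)) ≤ finrank ℝ (Submodule.span ℝ (Λ : Set E)) := by
  have := discreteTopology_of_eventually_eq_zero hΛ
  have hrank : finrank ℝ (Submodule.span ℝ (Λ : Set E)) = finrank ℤ Λ := by
    have h := Real.finrank_eq_int_finrank_of_discrete (E := E) (s := (Λ : Set E))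
      (by rwa [Submodule.span_eq])
    rwa [Set.finrank, Set.finrank, Submodule.span_eq] at h
  let b := Free.chooseBasis ℤ Λ
  have hspan : Submodule.span ℚ (Λ : Set E) =
      Submodule.span ℚ (range fun i ↦ ((b i : Λ) : E)) := by
    refine le_antisymm (Submodule.span_le.2 fun x hx ↦ ?_) (Submodule.span_mono ?_)
    · have h2 := congrArg Λ.subtype (b.sum_repr ⟨x, hx⟩)
      rw [map_sum] at h2
      have h3 : Λ.subtype ⟨x, hx⟩ = x := rfl
      rw [SetLike.mem_coe, ← h3, ← h2]
      refine sum_mem fun i _ ↦ ?_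
      rw [map_smul]
      exact zsmul_mem (Submodule.subset_span (mem_range_self i)) _
    · rintro _ ⟨i, rfl⟩
      exact (b i).2
  rw [hrank, hspan]
  refine ⟨Module.Finite.span_of_finite ℚ (finite_range _), (finrank_range_le_card _).trans ?_⟩
  rw [finrank_eq_card_chooseBasisIndex]

variable {ι : Type*} [Fintype ι] {A : E →ₗ[ℝ] E} {b : Basis ι ℝ E} {l : ι → ℝ}

theorem repr_aeval_eigenbasis (hA : ∀ i, A (b i) = l i • b i) {V : Submodule ℚ E}
    {T : V →ₗ[ℚ] V} (hT : ∀ x, (T x : E) = A x) (p : ℚ[X]) (x : V) (i : ι) :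
    b.repr (aeval T p x : V) i = aeval (l i) p * b.repr x i := by
  induction p using Polynomial.induction_on' with
  | add p q hp hq =>
    simp only [map_add, LinearMap.add_apply, Submodule.coe_add, Finsupp.add_apply, hp, hq, add_mul]
  | monomial n a =>
    have hpow : ((T ^ n) x : E) = (A ^ n) x := by
      induction n with
      | zero => simp
      | succ n ih => rw [pow_succ', pow_succ', Module.End.mul_apply, Module.End.mul_apply, hT, ih]
    rw [aeval_monomial, aeval_monomial, Module.End.mul_apply, Module.algebraMap_end_apply,
      Submodule.coe_smul, hpow]
    have := map_rat_smul (b.coord i) a ((A ^ n) (x : E))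
    rw [b.coord_apply, b.coord_apply, repr_pow_apply_eigenbasis hA, Rat.smul_def] at this
    rw [this, eq_ratCast, mul_assoc]

/-- A rational polynomial `p` in `T` multiplies the `i`-th real coordinate by `p (l i)`. If a power
of `p` annihilates, so does `p`: the annihilator is a radical ideal. -/
theorem squarefree_minpoly_of_eigenbasis (hA : ∀ i, A (b i) = l i • b i) {V : Submodule ℚ E}
    [Module.Finite ℚ V] {T : V →ₗ[ℚ] V} (hT : ∀ x, (T x : E) = A x) :
    Squarefree (minpoly ℚ T) := by
  refine IsRadical.squarefree (minpoly.ne_zero (Algebra.IsIntegral.isIntegral T)) ?_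
  intro n p hp
  refine minpoly.dvd ℚ T (LinearMap.ext fun x ↦ Subtype.ext (b.ext_elem fun i ↦ ?_))
  have h1 : aeval T (p ^ n) = 0 := by
    obtain ⟨q, hq⟩ := hp
    rw [hq, map_mul, minpoly.aeval, zero_mul]
  have h2 := repr_aeval_eigenbasis hA hT (p ^ n) x i
  rw [h1, map_pow] at h2
  rw [repr_aeval_eigenbasis hA hT]
  simp only [LinearMap.zero_apply, Submodule.coe_zero, map_zero, Finsupp.coe_zero, Pi.zero_apply,
    zero_eq_mul, mul_eq_zero] at h2 ⊢
  exact h2.imp eq_zero_of_pow_eq_zero id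

theorem span_real_invariant {U : Submodule ℚ E} (hAU : ∀ x ∈ U, A x ∈ U) {x : E}
    (hx : x ∈ Submodule.span ℝ (U : Set E)) : A x ∈ Submodule.span ℝ (U : Set E) := by
  have : Submodule.span ℝ (U : Set E) ≤ (Submodule.span ℝ (U : Set E)).comap A :=
    Submodule.span_le.2 fun y hy ↦ Submodule.subset_span (hAU y hy)
  exact this hx

/-- Clearing denominators moves each rational vector into `Λ` without changing its real line. This
is the form of rationality that later yields compact orbits. -/
theorem span_real_le_span_inter {U : Submodule ℚ E}
    (hU : U ≤ Submodule.span ℚ (Λ : Set E)) :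
    Submodule.span ℝ (U : Set E) ≤
      Submodule.span ℝ ((Submodule.span ℝ (U : Set E) : Set E) ∩ Λ) := by
  refine Submodule.span_le.2 fun x hx ↦ ?_
  obtain ⟨n, hn, hnx⟩ := exists_nsmul_mem_of_mem_span_rat Λ (hU hx)
  have h : n • x ∈ (Submodule.span ℝ (U : Set E) : Set E) ∩ Λ :=
    ⟨nsmul_mem (Submodule.subset_span hx) n, hnx⟩
  have h2 := Submodule.subset_span (R := ℝ) h
  rw [← Nat.cast_smul_eq_nsmul ℝ] at h2
  exact (Submodule.smul_mem_iff _ (Nat.cast_ne_zero.2 hn)).1 h2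

theorem exists_expanding_mem_span (hA : ∀ i, A (b i) = l i • b i)
    (hl : Injective (fun i ↦ |l i|)) (h1 : ∀ i, |l i| ≠ 1) (h0 : ∀ i, l i ≠ 0)
    (hΛ : ∀ᶠ x : E in 𝓝 0, x ∈ Λ → x = 0) (hAΛ : ∀ x ∈ Λ, A x ∈ Λ) {U : Submodule ℚ E}
    (hU0 : U ≠ ⊥) (hU : U ≤ Submodule.span ℚ (Λ : Set E)) (hAU : ∀ x ∈ U, A x ∈ U) :
    ∃ i, b i ∈ Submodule.span ℝ (U : Set E) ∧ 1 < |l i| := by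
  obtain ⟨x, hxU, hx0⟩ := U.exists_mem_ne_zero_of_ne_bot hU0
  obtain ⟨n, hn, hnx⟩ := exists_nsmul_mem_of_mem_span_rat Λ (hU hxU)
  have hnx0 : n • x ≠ 0 := by
    rw [← Nat.cast_smul_eq_nsmul ℚ]
    exact smul_ne_zero (Nat.cast_ne_zero.2 hn) hx0
  obtain ⟨i, hi, hli⟩ := exists_one_lt_abs_of_mem_discrete hA h1 h0 hΛ hAΛ hnx hnx0
  refine ⟨i, ?_, hli⟩
  exact eigenbasis_mem_of_invariant hA (fun i j hij ↦ hl (congrArg abs hij))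
    (fun y hy ↦ span_real_invariant hAU hy)
    (nsmul_mem (Submodule.subset_span hxU) n) hi

/-- If a hyperbolic automorphism of a lattice with simple spectrum is reducible over `ℚ`, there is
a rational invariant subspace containing an expanding eigenvector, such that a more strongly
expanding eigenvector lies outside. -/
theorem exists_expanding_pair [FiniteDimensional ℝ E] (hA : ∀ i, A (b i) = l i • b i)
    (hl : Injective (fun i ↦ |l i|)) (h1 : ∀ i, |l i| ≠ 1) (h0 : ∀ i, l i ≠ 0)
    (hΛ : ∀ᶠ x : E in 𝓝 0, x ∈ Λ → x = 0) (hAΛ : ∀ x ∈ Λ, A x ∈ Λ) {W : Submodule ℚ E}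
    (hW0 : W ≠ ⊥) (hW : W < Submodule.span ℚ (Λ : Set E)) (hAW : ∀ x ∈ W, A x ∈ W) :
    ∃ (i j : ι) (S : Submodule ℝ E), 1 < |l i| ∧ |l i| < |l j| ∧
      S ≤ Submodule.span ℝ ((S : Set E) ∩ Λ) ∧ (∀ x ∈ S, A x ∈ S) ∧ b i ∈ S ∧ b j ∈
        Submodule.span ℝ (Λ : Set E) ∧ b j ∉ S := by
  set V := Submodule.span ℚ (Λ : Set E) with hV
  obtain ⟨hfin, hrank⟩ := finite_span_rat_of_discrete hΛ
  rw [← hV] at hfin hrank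
  let Aq : E →ₗ[ℚ] E := A.toAddMonoidHom.toRatLinearMap
  have hAV : V ≤ V.comap Aq := Submodule.span_le.2 fun x hx ↦ Submodule.subset_span (hAΛ x hx)
  let T : V →ₗ[ℚ] V := Aq.restrict hAV
  have hT : ∀ x, (T x : E) = A x := fun x ↦ rfl
  have hss : Module.End.IsSemisimple T := Module.End.isSemisimple_of_squarefree_aeval_eq_zero
    (squarefree_minpoly_of_eigenbasis hA hT) (minpoly.aeval ℚ T)
  -- Semisimplicity over `ℚ` gives an invariant complement defined over `ℚ`; a real complement would
  -- not meet the lattice.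
  obtain ⟨Q, hQ, hcompl⟩ := Module.End.isSemisimple_iff.1 hss (W.comap V.subtype)
    (fun x hx ↦ hAW _ hx)
  set U := Q.map V.subtype with hU
  have hUV : U ≤ V := V.map_subtype_le Q
  have hAU : ∀ x ∈ U, A x ∈ U := by
    rintro _ ⟨x, hx, rfl⟩
    exact ⟨T x, hQ hx, rfl⟩
  have hWmap : (W.comap V.subtype).map V.subtype = W := by
    rw [Submodule.map_comap_subtype, inf_eq_right]
    exact hW.le
  have hU0 : U ≠ ⊥ := by
    intro h
    have hQ0 : Q = ⊥ := Submodule.map_injective_of_injective V.subtype_injective (by rw [← hU, h, Submodule.map_bot])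
    rw [hQ0] at hcompl
    have := hcompl.sup_eq_top
    rw [sup_bot_eq] at this
    rw [this, Submodule.map_subtype_top] at hWmap
    exact hW.ne hWmap.symm
  have hWfin : Module.Finite ℚ W := by rw [← hWmap]; infer_instance
  have hrW : finrank ℚ W = finrank ℚ (W.comap V.subtype) := by
    conv_lhs => rw [← hWmap]
    exact Submodule.finrank_map_subtype_eq V _
  have hrU : finrank ℚ U = finrank ℚ Q := Submodule.finrank_map_subtype_eq V _
  -- Dimension count: the real dimensions of the two spans add up to at most `dim_ℚ W + dim_ℚ U =
  -- dim_ℚ V`, which is at most the dimension of the span of `Λ`, hence of their sum.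
  have hdisj : Disjoint (Submodule.span ℝ (W : Set E)) (Submodule.span ℝ (U : Set E)) := by
    have hs := Submodule.finrank_sup_add_finrank_inf_eq (Submodule.span ℝ (W : Set E))
      (Submodule.span ℝ (U : Set E))
    have hsup : Submodule.span ℝ (Λ : Set E) ≤
        Submodule.span ℝ (W : Set E) ⊔ Submodule.span ℝ (U : Set E) := by
      refine Submodule.span_le.2 fun x hx ↦ ?_
      have hxV : x ∈ V := Submodule.subset_span hx
      have hxt : (⟨x, hxV⟩ : V) ∈ W.comap V.subtype ⊔ Q := by
        rw [hcompl.sup_eq_top]; trivial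
      obtain ⟨y, hy, z, hz, hyz⟩ := Submodule.mem_sup.1 hxt
      have : x = (y : E) + z := (congrArg Subtype.val hyz).symm
      rw [this]
      exact Submodule.add_mem_sup (Submodule.subset_span hy)
        (Submodule.subset_span ⟨z, hz, rfl⟩)
    have h3 := Submodule.finrank_mono hsup
    have h4 := finrank_span_real_le W
    have h5 := finrank_span_real_le U
    have h6 := Submodule.finrank_add_eq_of_isCompl hcompl
    rw [disjoint_iff, ← Submodule.finrank_eq_zero (R := ℝ)]
    omega
  obtain ⟨i, hiW, hi1⟩ := exists_expanding_mem_span hA hl h1 h0 hΛ hAΛ hW0 hW.le hAW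
  obtain ⟨j, hjU, hj1⟩ := exists_expanding_mem_span hA hl h1 h0 hΛ hAΛ hU0 hUV hAU
  have hspan : ∀ U ≤ V, Submodule.span ℝ (U : Set E) ≤ Submodule.span ℝ (Λ : Set E) :=
    fun U hU ↦ (span_real_le_span_inter hU).trans (Submodule.span_mono inter_subset_right)
  have hiU : b i ∉ Submodule.span ℝ (U : Set E) := fun h ↦
    b.ne_zero i (Submodule.disjoint_def.1 hdisj _ hiW h)
  have hjW : b j ∉ Submodule.span ℝ (W : Set E) := fun h ↦
    b.ne_zero j (Submodule.disjoint_def.1 hdisj _ h hjU)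
  have hij : |l i| ≠ |l j| := fun h ↦ hiU (hl h ▸ hjU)
  -- The roles of `W` and its complement are symmetric; `S` is the span containing the weaker
  -- eigenvector.
  rcases hij.lt_or_gt with h | h
  · exact ⟨i, j, _, hi1, h, span_real_le_span_inter hW.le, fun x hx ↦ span_real_invariant hAW hx,
      hiW, hspan U hUV hjU, hjW⟩
  · exact ⟨j, i, _, hj1, h, span_real_le_span_inter hUV, fun x hx ↦ span_real_invariant hAU hx,
      hjU, hspan W hW.le hiW, hiU⟩

end Selection

end LinearAlgebra

/-! ## The action of `N` on `N ⧸ Γ` -/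

section Action

variable {E : Type*} [NormedAddCommGroup E] [NormedSpace ℝ E]
  {N : Type*} [TopologicalSpace N] [ChartedSpace E N] [Group N] {Γ : Subgroup N}

theorem LatticeAut.quotientEquiv_smul (L : LatticeAut E Γ) (y : N) (q : N ⧸ Γ) :
    L.quotientEquiv (y • q) = L.toMulEquiv y • L.quotientEquiv q := by
  obtain ⟨x, rfl⟩ := QuotientGroup.mk_surjective q
  change L.quotientEquiv ((y * x : N) : N ⧸ Γ) = _
  rw [L.quotientEquiv_mk, L.quotientEquiv_mk, map_mul]
  rfl

variable [LieGroup 𝓘(ℝ, E) ∞ N]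

/-! ### Translations by central elements. -/

section Central

variable [T2Space N]

theorem centralExp_smul_comm (X : centralLie E N) (y : N) (q : N ⧸ Γ) :
    centralExp X • y • q = y • centralExp X • q := by
  rw [smul_smul, smul_smul, centralExp_mul_comm]

theorem centralExp_add_smul (X Y : centralLie E N) (q : N ⧸ Γ) :
    centralExp (X + Y) • q = centralExp X • centralExp Y • q := by
  rw [smul_smul, centralExp_add]

theorem centralExp_smul_of_mem {X : centralLie E N} (hX : centralExp X ∈ Γ) (q : N ⧸ Γ) :
    centralExp X • q = q := by
  obtain ⟨x, rfl⟩ := QuotientGroup.mk_surjective q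
  change ((centralExp X * x : N) : N ⧸ Γ) = x
  rw [centralExp_mul_comm]
  exact QuotientGroup.mk_mul_of_mem x hX

theorem LatticeAut.quotientEquiv_centralExp_smul (L : LatticeAut E Γ) (X : centralLie E N)
    (q : N ⧸ Γ) :
    L.quotientEquiv (centralExp X • q) = centralExp (L.centralMap X) • L.quotientEquiv q := by
  rw [L.quotientEquiv_smul, L.centralExp_centralMap]

end Central

variable [DiscreteTopology Γ]

theorem contMDiff_smul_quotient :
    ContMDiff (𝓘(ℝ, E).prod 𝓘(ℝ, E)) 𝓘(ℝ, E) ∞ (fun p : N × (N ⧸ Γ) ↦ p.1 • p.2) := by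
  rintro ⟨y, q⟩
  have hq : q ∈ (quotientSection (E := E) Γ q).source := (mem_chart_source E q).1
  have h1 : ContMDiffAt (𝓘(ℝ, E).prod 𝓘(ℝ, E)) 𝓘(ℝ, E) ∞
      (fun p : N × (N ⧸ Γ) ↦ quotientSection (E := E) Γ q p.2) (y, q) :=
    ContMDiffAt.comp (y, q) (contMDiffAt_quotientSection (E := E) Γ q) contMDiffAt_snd
  have h2 := (contMDiff_quotientMk (E := E) Γ).contMDiffAt.comp (y, q)
    (contMDiffAt_fst.mul h1)
  refine h2.congr_of_eventuallyEq ?_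
  filter_upwards [continuousAt_snd.eventually
    ((quotientSection (E := E) Γ q).open_source.mem_nhds hq)] with p hp
  conv_lhs =>
    rw [← (isLocalHomeomorph_quotientMk E Γ).apply_localInverseAt_of_mem hp]
  rfl

/-- Near `1`, the orbit map followed by a local section of the projection is a right translation.
Undoing that translation gives a left inverse of the derivative, an injective endomorphism of a
finite-dimensional space. -/
theorem exists_equiv_hasModelDeriv_orbit [FiniteDimensional ℝ E] (q : N ⧸ Γ) :
    ∃ A : E ≃L[ℝ] E, HasModelDeriv (fun y : N ↦ y • q) 1 (A : E →L[ℝ] E) := by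
  have hsm : ContMDiff 𝓘(ℝ, E) 𝓘(ℝ, E) ∞ (fun y : N ↦ y • q) :=
    contMDiff_smul_quotient.comp (contMDiff_id.prodMk contMDiff_const)
  have h1 := (hsm 1).hasModelDeriv (by simp)
  set B : E →L[ℝ] E := modelDeriv (fun y : N ↦ y • q) 1 with hB
  have hq : q ∈ (quotientSection (E := E) Γ q).source := (mem_chart_source E q).1
  obtain ⟨x, rfl⟩ := QuotientGroup.mk_surjective q
  obtain ⟨γ, hγ⟩ := quotientSection_mk_eventuallyEq (E := E) Γ _ x hq
  have h2 := (contMDiffAt_quotientSection (E := E) Γ (x : N ⧸ Γ)).hasModelDeriv (by simp)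
  have hR : ContMDiff 𝓘(ℝ, E) 𝓘(ℝ, E) ∞ (fun y : N ↦ y * (x * γ)⁻¹) := contMDiff_mul_right
  have h3 := (hR (quotientSection (E := E) Γ (x : N ⧸ Γ) (x : N ⧸ Γ))).hasModelDeriv (by simp)
  have h4 := h3.comp (h2.comp h1 (one_smul N (x : N ⧸ Γ))) (by rw [one_smul])
  have h5 : HasModelDeriv (fun y : N ↦ y) 1 _ := h4.congr (by
    have : IsTopologicalGroup N := topologicalGroup_of_lieGroup 𝓘(ℝ, E) ∞
    have hc : ContinuousAt (fun y : N ↦ y * x) 1 := by fun_prop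
    have hc' : Tendsto (fun y : N ↦ y * x) (𝓝 1) (𝓝 x) := by simpa [ContinuousAt] using hc
    filter_upwards [hc'.eventually hγ] with y hy
    have h6 : y • (x : N ⧸ Γ) = ((y * x : N) : N ⧸ Γ) := rfl
    rw [h6, hy]
    group)
  have h6 := h5.unique (hasModelDeriv_id (E := E) (1 : N))
  have hinj : Injective B := by
    refine LeftInverse.injective (g := fun z ↦ modelDeriv (fun y : N ↦ y * (x * γ)⁻¹)
      (quotientSection (E := E) Γ (x : N ⧸ Γ) (x : N ⧸ Γ))
      (modelDeriv (quotientSection (E := E) Γ (x : N ⧸ Γ)) (x : N ⧸ Γ) z : E)) fun z ↦ ?_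
    exact congrArg (fun C : E →L[ℝ] E ↦ C z) h6
  let e : E ≃ₗ[ℝ] E := LinearEquiv.ofInjectiveEndo (B : E →ₗ[ℝ] E) hinj
  refine ⟨e.toContinuousLinearEquiv, ?_⟩
  have : ((e.toContinuousLinearEquiv : E ≃L[ℝ] E) : E →L[ℝ] E) = B := by ext; rfl
  rw [this]
  exact h1

/-- The derivative at the identity of the orbit map `y ↦ y • q`. -/
def orbitDeriv [FiniteDimensional ℝ E] (q : N ⧸ Γ) : E ≃L[ℝ] E :=
  (exists_equiv_hasModelDeriv_orbit q).choose

theorem hasModelDeriv_orbit [FiniteDimensional ℝ E] (q : N ⧸ Γ) :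
    HasModelDeriv (fun y : N ↦ y • q) 1 (orbitDeriv (E := E) q : E →L[ℝ] E) :=
  (exists_equiv_hasModelDeriv_orbit q).choose_spec

theorem t2Space_quotient_of_discrete (E : Type*) [NormedAddCommGroup E] [NormedSpace ℝ E]
    [FiniteDimensional ℝ E] {N : Type*} [TopologicalSpace N] [T2Space N] [ChartedSpace E N]
    [Group N] [LieGroup 𝓘(ℝ, E) ∞ N] (Γ : Subgroup N) [DiscreteTopology Γ] : T2Space (N ⧸ Γ) := by
  have : IsTopologicalGroup N := topologicalGroup_of_lieGroup 𝓘(ℝ, E) ∞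
  have : IsClosed (Γ : Set N) := Γ.isClosed_of_discrete
  exact QuotientGroup.instT2Space

variable [T2Space N]

theorem contMDiff_centralExp_smul [FiniteDimensional ℝ E] :
    ContMDiff (𝓘(ℝ, centralLie E N).prod 𝓘(ℝ, E)) 𝓘(ℝ, E) ∞
      (fun p : centralLie E N × (N ⧸ Γ) ↦ centralExp p.1 • p.2) :=
  contMDiff_smul_quotient.comp ((contMDiff_centralExp.comp contMDiff_fst).prodMk contMDiff_snd)

theorem hasModelDeriv_centralExp_smul [FiniteDimensional ℝ E] (q : N ⧸ Γ) :
    HasModelDeriv (fun X : centralLie E N ↦ centralExp X • q) 0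
      ((orbitDeriv (E := E) q : E →L[ℝ] E).comp (centralLie E N).subtypeL) :=
  (hasModelDeriv_orbit q).comp hasModelDeriv_centralExp centralExp_zero

end Action

/-! ## Averaging over central tori -/

section Average

open MeasureTheory

variable {E : Type*} [NormedAddCommGroup E] [NormedSpace ℝ E]

/-- The integral is the value at `0` of a convolution of the indicator of `(0, 1]` with a function
depending smoothly on a parameter and supported in a fixed compact set. -/
theorem contDiffOn_intervalIntegral_param {H : ℝ × E → ℝ} {s : Set E} (hs : IsOpen s)
    (hH : ContDiffOn ℝ ∞ H (univ ×ˢ s)) :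
    ContDiffOn ℝ ∞ (fun y ↦ ∫ t in (0 : ℝ)..1, H (t, y)) s := by
  let χ : ContDiffBump (0 : ℝ) := ⟨1, 2, one_pos, one_lt_two⟩
  let f : ℝ → ℝ := indicator (Ioc 0 1) fun _ ↦ 1
  -- The sign compensates for the convolution at `0` evaluating at `0 - t`; the cutoff is `1` on the
  -- interval of integration.
  let g : E → ℝ → ℝ := fun y t ↦ χ (-t) * H (-t, y)
  have hf : LocallyIntegrable f volume :=
    ((integrable_indicator_iff measurableSet_Ioc).2
      (integrableOn_const (by simp))).locallyIntegrable
  have hg : ContDiffOn ℝ ∞ ↿g (s ×ˢ univ) := by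
    refine ContDiffOn.mul ?_ ?_
    · exact (χ.contDiff.comp (contDiff_snd.neg)).contDiffOn
    · refine hH.comp (g := H) (f := fun p : E × ℝ ↦ (-p.2, p.1)) ?_ ?_
      · exact (contDiff_snd.neg.prodMk contDiff_fst).contDiffOn
      · rintro p hp; exact ⟨trivial, hp.1⟩
  have hgs : ∀ y, ∀ t, y ∈ s → t ∉ Metric.closedBall (0 : ℝ) 2 → g y t = 0 := by
    intro y t _ ht
    have : χ (-t) = 0 := χ.zero_of_le_dist (by
      rw [Metric.mem_closedBall, not_le] at ht
      simpa using ht.le)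
    simp only [g, this, zero_mul]
  have h := contDiffOn_convolution_right_with_param (μ := volume)
    (ContinuousLinearMap.mul ℝ ℝ) hs
    (isCompact_closedBall (0 : ℝ) 2) hgs hf hg
  have h2 : ContDiffOn ℝ ∞ (fun y : E ↦ (y, (0 : ℝ))) s :=
    (contDiff_id.prodMk contDiff_const).contDiffOn
  refine (h.comp h2 fun y hy ↦ ⟨hy, trivial⟩).congr fun y _ ↦ ?_
  rw [intervalIntegral.integral_of_le zero_le_one]
  simp only [comp_apply, convolution_def, f, g, ContinuousLinearMap.mul_apply']
  rw [← integral_indicator measurableSet_Ioc]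
  refine integral_congr_ae (Eventually.of_forall fun t ↦ ?_)
  by_cases ht : t ∈ Ioc (0 : ℝ) 1
  · have : χ t = 1 := χ.one_of_mem_closedBall (by
      rw [mem_closedBall_zero_iff, Real.norm_eq_abs, abs_of_pos ht.1]; exact ht.2)
    simp [ht, this]
  · simp [ht]

theorem contMDiff_intervalIntegral_param {M : Type*} [TopologicalSpace M] [ChartedSpace E M]
    [IsManifold 𝓘(ℝ, E) ∞ M] {F : ℝ × M → ℝ}
    (hF : ContMDiff (𝓘(ℝ, ℝ).prod 𝓘(ℝ, E)) 𝓘(ℝ, ℝ) ∞ F) :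
    ContMDiff 𝓘(ℝ, E) 𝓘(ℝ, ℝ) ∞ (fun x ↦ ∫ t in (0 : ℝ)..1, F (t, x)) := by
  intro x₀
  let c := chartAt E x₀
  have h1 : ContDiffOn ℝ ∞ (fun p : ℝ × E ↦ F (p.1, c.symm p.2)) (univ ×ˢ c.target) := by
    rintro ⟨t, y⟩ ⟨-, hy⟩
    have h2 : ContMDiffAt 𝓘(ℝ, E) 𝓘(ℝ, E) ∞ c.symm y :=
      (contMDiffOn_chart_symm (n := ∞)).contMDiffAt (c.open_target.mem_nhds hy)
    have h3 : ContMDiffAt 𝓘(ℝ, ℝ × E) 𝓘(ℝ, E) ∞ (fun p : ℝ × E ↦ c.symm p.2) (t, y) :=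
      ContMDiffAt.comp (t, y) h2 contDiff_snd.contMDiff.contMDiffAt
    have h4 : ContMDiffAt 𝓘(ℝ, ℝ × E) 𝓘(ℝ, ℝ) ∞ (fun p : ℝ × E ↦ p.1) (t, y) :=
      contDiff_fst.contMDiff.contMDiffAt
    exact (ContMDiffAt.comp (t, y) hF.contMDiffAt (h4.prodMk h3)).contDiffAt.contDiffWithinAt
  have h2 := contDiffOn_intervalIntegral_param c.open_target h1
  have h3 : ContMDiffAt 𝓘(ℝ, E) 𝓘(ℝ, E) ∞ c x₀ :=
    (contMDiffOn_chart (n := ∞)).contMDiffAt (chart_source_mem_nhds E x₀)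
  have h4 := (h2.contDiffAt (c.open_target.mem_nhds (mem_chart_target E x₀))).contMDiffAt
  refine (ContMDiffAt.comp x₀ h4 h3).congr_of_eventuallyEq ?_
  filter_upwards [chart_source_mem_nhds E x₀] with x hx
  simp only [comp_apply]
  rw [c.left_inv hx]

variable {N : Type*} [TopologicalSpace N] [ChartedSpace E N] [Group N]
  [LieGroup 𝓘(ℝ, E) ∞ N] {Γ : Subgroup N}

/-- The average of `φ` over the orbits of the one-parameter group generated by `X`. -/
def centralAverage (X : centralLie E N) (φ : N ⧸ Γ → ℝ) (q : N ⧸ Γ) : ℝ :=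
  ∫ t in (0 : ℝ)..1, φ (centralExp (t • X) • q)

theorem centralAverage_eq_const {X : centralLie E N} {φ : N ⧸ Γ → ℝ} {q : N ⧸ Γ} {c : ℝ}
    (h : ∀ t : ℝ, φ (centralExp (t • X) • q) = c) : centralAverage X φ q = c := by
  simp [centralAverage, h]

variable [T2Space N]

theorem centralAverage_invariant_of_invariant {X Y : centralLie E N} {φ : N ⧸ Γ → ℝ}
    (h : ∀ q, φ (centralExp Y • q) = φ q) (q : N ⧸ Γ) :
    centralAverage X φ (centralExp Y • q) = centralAverage X φ q := by
  simp only [centralAverage, centralExp_smul_comm _ (centralExp Y), h]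

/-- Since `exp X ∈ Γ` is central it acts trivially, so the integrand has period `1` and the integral
may start anywhere. -/
theorem centralAverage_invariant {X : centralLie E N} (hX : centralExp X ∈ Γ) (φ : N ⧸ Γ → ℝ)
    (s : ℝ) (q : N ⧸ Γ) :
    centralAverage X φ (centralExp (s • X) • q) = centralAverage X φ q := by
  have hper : Periodic (fun t : ℝ ↦ φ (centralExp (t • X) • q)) 1 := by
    intro t
    simp only [add_smul, one_smul, centralExp_add_smul, centralExp_smul_of_mem hX]
  have h := hper.intervalIntegral_add_eq s 0
  have h2 := intervalIntegral.integral_comp_add_right (a := 0) (b := 1)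
    (fun t : ℝ ↦ φ (centralExp (t • X) • q)) s
  rw [zero_add, add_comm 1 s] at h2
  rw [zero_add] at h
  simp only [centralAverage, ← centralExp_add_smul, ← add_smul]
  exact h2.trans h

/-- The union of the orbits of points of `K` under the central group with Lie algebra `S`. -/
def centralSaturation (S : Submodule ℝ (centralLie E N)) (K : Set (N ⧸ Γ)) : Set (N ⧸ Γ) :=
  {q | ∃ Y ∈ S, ∃ p ∈ K, centralExp Y • p = q}

theorem subset_centralSaturation (S : Submodule ℝ (centralLie E N)) (K : Set (N ⧸ Γ)) :
    K ⊆ centralSaturation S K := fun q hq ↦ ⟨0, zero_mem S, q, hq, by simp⟩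

theorem centralExp_smul_mem_centralSaturation {S : Submodule ℝ (centralLie E N)}
    {K : Set (N ⧸ Γ)} {Y : centralLie E N} (hY : Y ∈ S) {q : N ⧸ Γ}
    (hq : q ∈ centralSaturation S K) : centralExp Y • q ∈ centralSaturation S K := by
  obtain ⟨Z, hZ, p, hp, rfl⟩ := hq
  exact ⟨Y + Z, add_mem hY hZ, p, hp, centralExp_add_smul Y Z p⟩

variable [FiniteDimensional ℝ E] [DiscreteTopology Γ]

theorem contMDiff_centralAverage (X : centralLie E N) {φ : N ⧸ Γ → ℝ}
    (hφ : ContMDiff 𝓘(ℝ, E) 𝓘(ℝ, ℝ) ∞ φ) :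
    ContMDiff 𝓘(ℝ, E) 𝓘(ℝ, ℝ) ∞ (centralAverage X φ) := by
  have h1 : ContMDiff 𝓘(ℝ, ℝ) 𝓘(ℝ, centralLie E N) ∞ (fun t : ℝ ↦ t • X) :=
    ContDiff.contMDiff (by fun_prop)
  exact contMDiff_intervalIntegral_param (F := fun p ↦ φ (centralExp (p.1 • X) • p.2))
    (hφ.comp (contMDiff_centralExp_smul.comp ((h1.comp contMDiff_fst).prodMk contMDiff_snd)))

theorem centralAverage_mem_Icc (X : centralLie E N) {φ : N ⧸ Γ → ℝ} (hφ : Continuous φ)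
    (h : ∀ q, φ q ∈ Icc 0 1) (q : N ⧸ Γ) : centralAverage X φ q ∈ Icc 0 1 := by
  have h1 : Continuous (fun t : ℝ ↦ (t • X, q)) := by fun_prop
  have h2 : Continuous (fun t : ℝ ↦ φ (centralExp (t • X) • q)) :=
    hφ.comp ((contMDiff_centralExp_smul (E := E) (Γ := Γ)).continuous.comp h1)
  refine ⟨intervalIntegral.integral_nonneg zero_le_one fun t _ ↦ (h _).1, ?_⟩
  calc centralAverage X φ q ≤ ∫ t in (0 : ℝ)..1, (1 : ℝ) :=
        intervalIntegral.integral_mono_on zero_le_one (h2.intervalIntegrable _ _) (by simp)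
          fun t _ ↦ (h _).2
    _ = 1 := by simp

variable {k : ℕ} {e : Fin k → centralLie E N}

/-- Integer combinations of the `e i` act trivially, so only coefficients in the compact unit cube
matter. -/
theorem IsCompact.centralSaturation (he : ∀ i, centralExp (e i) ∈ Γ) {K : Set (N ⧸ Γ)}
    (hK : IsCompact K) : IsCompact (centralSaturation (Submodule.span ℝ (range e)) K) := by
  have hbox : IsCompact (Icc (0 : Fin k → ℝ) 1) := isCompact_Icc
  have hc : Continuous (fun p : (Fin k → ℝ) × (N ⧸ Γ) ↦ centralExp (∑ i, p.1 i • e i) • p.2) := by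
    have h1 : Continuous (fun p : (Fin k → ℝ) × (N ⧸ Γ) ↦ (∑ i, p.1 i • e i, p.2)) := by fun_prop
    exact (contMDiff_centralExp_smul (E := E) (Γ := Γ)).continuous.comp h1
  convert (hbox.prod hK).image hc using 1
  ext q
  constructor
  · rintro ⟨Y, hY, p, hp, rfl⟩
    obtain ⟨c, rfl⟩ := (Submodule.mem_span_range_iff_exists_fun ℝ).1 hY
    refine ⟨(fun i ↦ Int.fract (c i), p), ⟨⟨fun i ↦ Int.fract_nonneg _,
      fun i ↦ (Int.fract_lt_one _).le⟩, hp⟩, ?_⟩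
    have hfl : centralExp (∑ i, ⌊c i⌋ • e i) ∈ Γ := by
      have h1 : ((∑ i, ⌊c i⌋ • e i : centralLie E N) : E) ∈ centralLattice E Γ := by
        rw [Submodule.coe_sum]
        refine sum_mem fun i _ ↦ ?_
        rw [Submodule.coe_smul_of_tower]
        exact zsmul_mem (mem_centralLattice.2 ⟨(e i).2, he i⟩) _
      exact (mem_centralLattice.1 h1).2
    have hsum : ∑ i, c i • e i = ∑ i, Int.fract (c i) • e i + ∑ i, ⌊c i⌋ • e i := by
      rw [← Finset.sum_add_distrib]
      refine Finset.sum_congr rfl fun i _ ↦ ?_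
      rw [← Int.cast_smul_eq_zsmul ℝ, ← add_smul, Int.fract_add_floor]
    rw [hsum, centralExp_add_smul, centralExp_smul_of_mem hfl]
  · rintro ⟨⟨c, p⟩, ⟨-, hp⟩, rfl⟩
    exact ⟨_, (Submodule.mem_span_range_iff_exists_fun ℝ).2 ⟨c, rfl⟩, p, hp, rfl⟩

/-- Smooth invariant functions separate compact sets with disjoint saturations. -/
theorem exists_contMDiff_invariant [CompactSpace (N ⧸ Γ)] (he : ∀ i, centralExp (e i) ∈ Γ)
    {K₀ K₁ : Set (N ⧸ Γ)} (hK₀ : IsCompact K₀) (hK₁ : IsCompact K₁)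
    (hK : Disjoint (centralSaturation (Submodule.span ℝ (range e)) K₀)
      (centralSaturation (Submodule.span ℝ (range e)) K₁)) :
    ∃ φ : N ⧸ Γ → ℝ, ContMDiff 𝓘(ℝ, E) 𝓘(ℝ, ℝ) ∞ φ ∧ (∀ q, φ q ∈ Icc 0 1) ∧
      (∀ q ∈ K₀, φ q = 0) ∧ (∀ q ∈ K₁, φ q = 1) ∧
      ∀ Y ∈ Submodule.span ℝ (range e), ∀ q, φ (centralExp Y • q) = φ q := by
  have := t2Space_quotient_of_discrete E Γ
  set S := Submodule.span ℝ (range e) with hS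
  have heS : ∀ i, e i ∈ S := fun i ↦ Submodule.subset_span (mem_range_self i)
  -- Average over one generator at a time. Central translations commute, so earlier invariances
  -- survive. Requiring the values `0` and `1` on whole saturations lets them survive too.
  have key : ∀ s : Finset (Fin k), ∃ φ : N ⧸ Γ → ℝ, ContMDiff 𝓘(ℝ, E) 𝓘(ℝ, ℝ) ∞ φ ∧
      (∀ q, φ q ∈ Icc 0 1) ∧ (∀ q ∈ centralSaturation S K₀, φ q = 0) ∧
      (∀ q ∈ centralSaturation S K₁, φ q = 1) ∧
      ∀ i ∈ s, ∀ (t : ℝ) (q : N ⧸ Γ), φ (centralExp (t • e i) • q) = φ q := by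
    intro s
    induction s using Finset.induction_on with
    | empty =>
      obtain ⟨f, h0, h1, h01⟩ := exists_contMDiffMap_zero_one_of_isClosed (n := (⊤ : ℕ∞)) 𝓘(ℝ, E)
        (hK₀.centralSaturation he).isClosed (hK₁.centralSaturation he).isClosed hK
      exact ⟨f, f.contMDiff, h01, h0, h1, by simp⟩
    | insert i s hi ih =>
      obtain ⟨φ, hφ, h01, h0, h1, hinv⟩ := ih
      refine ⟨centralAverage (e i) φ, contMDiff_centralAverage _ hφ,
        centralAverage_mem_Icc _ hφ.continuous h01, fun q hq ↦ ?_, fun q hq ↦ ?_, ?_⟩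
      · exact centralAverage_eq_const fun t ↦
          h0 _ (centralExp_smul_mem_centralSaturation (S.smul_mem t (heS i)) hq)
      · exact centralAverage_eq_const fun t ↦
          h1 _ (centralExp_smul_mem_centralSaturation (S.smul_mem t (heS i)) hq)
      · intro j hj t q
        rcases Finset.mem_insert.1 hj with rfl | hj
        · exact centralAverage_invariant (he j) φ t q
        · exact centralAverage_invariant_of_invariant (fun q ↦ hinv j hj t q) q
  obtain ⟨φ, hφ, h01, h0, h1, hinv⟩ := key Finset.univ
  refine ⟨φ, hφ, h01, fun q hq ↦ h0 q (subset_centralSaturation S K₀ hq),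
    fun q hq ↦ h1 q (subset_centralSaturation S K₁ hq), fun Y hY ↦ ?_⟩
  have hadd : ∀ s : Finset (Fin k), ∀ (c : Fin k → ℝ) (q : N ⧸ Γ),
      φ (centralExp (∑ i ∈ s, c i • e i) • q) = φ q := by
    intro s c
    induction s using Finset.induction_on with
    | empty => simp
    | insert i s hi ih =>
      intro q
      rw [Finset.sum_insert hi, centralExp_add_smul, hinv i (Finset.mem_univ i), ih]
  obtain ⟨c, rfl⟩ := (Submodule.mem_span_range_iff_exists_fun ℝ).1 hY
  exact hadd _ c

end Average

/-! ## Perturbing a nilmanifold automorphism along a central eigenvector -/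

section Perturbation

variable {E : Type*} [NormedAddCommGroup E] [NormedSpace ℝ E]
-- The derivative in charts is `C^1`, hence locally Lipschitz, so the Hölder exponent is `1`.
theorem isC1Plus_of_contMDiff {M : Type*} [TopologicalSpace M] [ChartedSpace E M]
    [IsManifold 𝓘(ℝ, E) ∞ M] {g : M → M} (hg : ContMDiff 𝓘(ℝ, E) 𝓘(ℝ, E) ∞ g) :
    IsC1Plus (E := E) g := by
  refine ⟨hg.of_le (by simp), 1, one_pos, fun x ↦ ?_⟩
  have h1 : ContDiffAt ℝ ∞ (writtenInExtChartAt 𝓘(ℝ, E) 𝓘(ℝ, E) x g)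
      (extChartAt 𝓘(ℝ, E) x x) := by
    have := (contMDiffAt_iff.1 (hg x)).2
    rw [ModelWithCorners.range_eq_univ, contDiffWithinAt_univ] at this
    exact this
  obtain ⟨K, s, hs, hK⟩ := (h1.fderiv_right (m := 1) (by norm_cast)).exists_lipschitzOnWith
  exact ⟨K, s, hs, hK.holderOnWith⟩

variable {N : Type*} [TopologicalSpace N] [ChartedSpace E N] [Group N] {Γ : Subgroup N}

/-- The translation function of the conjugacy between `L` and its perturbation. -/
def conjCocycle (L : LatticeAut E Γ) (c : ℝ) (ψ : N ⧸ Γ → ℝ) (q : N ⧸ Γ) : ℝ :=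
  ∑' k : ℕ, (c ^ (k + 1))⁻¹ * ψ (L.quotientEquiv^[k] q)

variable {L : LatticeAut E Γ} {c : ℝ} {ψ : N ⧸ Γ → ℝ}

theorem norm_conjCocycle_term_le {C : ℝ} (hC : ∀ q, |ψ q| ≤ C) (k : ℕ) (q : N ⧸ Γ) :
    ‖(c ^ (k + 1))⁻¹ * ψ (L.quotientEquiv^[k] q)‖ ≤ |c|⁻¹ ^ (k + 1) * C := by
  rw [norm_mul, norm_inv, norm_pow, Real.norm_eq_abs, Real.norm_eq_abs, inv_pow]
  exact mul_le_mul_of_nonneg_left (hC _) (by positivity)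

theorem summable_geometric_bound {c : ℝ} (hc : 1 < |c|) (C : ℝ) :
    Summable (fun k : ℕ ↦ |c|⁻¹ ^ (k + 1) * C) :=
  ((summable_nat_add_iff 1).2 (summable_geometric_of_lt_one (by positivity)
    (inv_lt_one_of_one_lt₀ hc))).mul_right C

theorem summable_conjCocycle (hc : 1 < |c|) {C : ℝ} (hC : ∀ q, |ψ q| ≤ C) (q : N ⧸ Γ) :
    Summable (fun k : ℕ ↦ (c ^ (k + 1))⁻¹ * ψ (L.quotientEquiv^[k] q)) :=
  Summable.of_norm_bounded (summable_geometric_bound hc C)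
    fun k ↦ norm_conjCocycle_term_le hC k q

/-- Splitting off the first term of the series gives the twisted cohomological equation equivalent
to conjugacy. -/
theorem mul_conjCocycle (hc : 1 < |c|) {C : ℝ} (hC : ∀ q, |ψ q| ≤ C) (q : N ⧸ Γ) :
    c * conjCocycle L c ψ q = ψ q + conjCocycle L c ψ (L.quotientEquiv q) := by
  have hc0 : c ≠ 0 := by rintro rfl; norm_num at hc
  rw [conjCocycle, (summable_conjCocycle hc hC q).tsum_eq_zero_add, mul_add, ← tsum_mul_left]
  congr 1
  · simp; field_simp
  · refine tsum_congr fun k ↦ ?_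
    rw [iterate_succ_apply, pow_succ c (k + 1)]
    field_simp

variable [LieGroup 𝓘(ℝ, E) ∞ N]

theorem contMDiff_quotientEquiv [DiscreteTopology Γ] (L : LatticeAut E Γ) :
    ContMDiff 𝓘(ℝ, E) 𝓘(ℝ, E) ∞ L.quotientEquiv := by
  intro q
  have h1 := contMDiffAt_quotientSection (E := E) Γ q
  have h2 : ContMDiffAt 𝓘(ℝ, E) 𝓘(ℝ, E) ∞ (fun x : N ↦ (L.toMulEquiv x : N ⧸ Γ))
      (quotientSection (E := E) Γ q q) :=
    ((contMDiff_quotientMk Γ).comp L.contMDiff_toFun).contMDiffAt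
  have hq : q ∈ (quotientSection (E := E) Γ q).source := (mem_chart_source E q).1
  refine (h2.comp q h1).congr_of_eventuallyEq ?_
  filter_upwards [(quotientSection (E := E) Γ q).open_source.mem_nhds hq] with z hz
  conv_lhs =>
    rw [← (isLocalHomeomorph_quotientMk E Γ).apply_localInverseAt_of_mem hz]
  rfl

theorem continuous_conjCocycle [DiscreteTopology Γ] (hc : 1 < |c|) {C : ℝ} (hC : ∀ q, |ψ q| ≤ C)
    (hψ : Continuous ψ) : Continuous (conjCocycle L c ψ) := by
  refine continuous_tsum (fun k ↦ ?_) (summable_geometric_bound hc C)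
    fun k q ↦ norm_conjCocycle_term_le hC k q
  exact continuous_const.mul (hψ.comp ((contMDiff_quotientEquiv L).continuous.iterate k))

/-- The skew perturbation `q ↦ exp (ψ q • v) • L q` of the map induced by `L`. -/
def perturb (L : LatticeAut E Γ) (v : centralLie E N) (ψ : N ⧸ Γ → ℝ) (q : N ⧸ Γ) : N ⧸ Γ :=
  centralExp (ψ q • v) • L.quotientEquiv q

variable [T2Space N] {v : centralLie E N}

theorem iterate_quotientEquiv_centralExp_smul (hv : L.centralMap v = c • v) (k : ℕ) (s : ℝ)
    (q : N ⧸ Γ) : L.quotientEquiv^[k] (centralExp (s • v) • q) =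
      centralExp ((c ^ k * s) • v) • L.quotientEquiv^[k] q := by
  induction k with
  | zero => simp
  | succ k ih =>
    rw [iterate_succ_apply', iterate_succ_apply', ih, L.quotientEquiv_centralExp_smul, map_smul, hv,
      smul_smul]
    congr 3
    ring

/-- `L^k` sends `v`-orbits to `v`-orbits, on which `ψ` is constant. Hence `h` is a translation on
each `v`-orbit and is inverted by changing the sign of `u`. -/
theorem conjCocycle_centralExp_smul (hv : L.centralMap v = c • v)
    (hψ : ∀ (s : ℝ) q, ψ (centralExp (s • v) • q) = ψ q) (s : ℝ) (q : N ⧸ Γ) :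
    conjCocycle L c ψ (centralExp (s • v) • q) = conjCocycle L c ψ q := by
  simp only [conjCocycle, iterate_quotientEquiv_centralExp_smul hv, hψ]

/-- The conjugacy `q ↦ exp (u q • v) • q` between `L` and its perturbation. -/
def conjMap (L : LatticeAut E Γ) (v : centralLie E N) (c : ℝ) (ψ : N ⧸ Γ → ℝ) (q : N ⧸ Γ) : N ⧸ Γ := centralExp (conjCocycle L c ψ q • v) • q

theorem quotientEquiv_conjMap (hv : L.centralMap v = c • v)
    (hψ : ∀ (s : ℝ) q, ψ (centralExp (s • v) • q) = ψ q) (hc : 1 < |c|) {C : ℝ}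
    (hC : ∀ q, |ψ q| ≤ C) (q : N ⧸ Γ) :
    L.quotientEquiv (conjMap L v c ψ q) = conjMap L v c ψ (perturb L v ψ q) := by
  rw [conjMap, conjMap, L.quotientEquiv_centralExp_smul, map_smul, hv, smul_smul, perturb,
    conjCocycle_centralExp_smul hv hψ, ← centralExp_add_smul, ← add_smul, mul_comm,
    mul_conjCocycle hc hC, add_comm]

variable [DiscreteTopology Γ]

variable [FiniteDimensional ℝ E]

theorem continuous_centralExp_smul {X : N ⧸ Γ → centralLie E N} (hX : Continuous X)
    {F : N ⧸ Γ → N ⧸ Γ} (hF : Continuous F) : Continuous (fun q ↦ centralExp (X q) • F q) :=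
  (contMDiff_centralExp_smul (E := E) (Γ := Γ)).continuous.comp (hX.prodMk hF)

/-- The conjugacy between `L` and its perturbation is a homeomorphism. -/
def conjHomeo (hv : L.centralMap v = c • v)
    (hψ : ∀ (s : ℝ) q, ψ (centralExp (s • v) • q) = ψ q) (hc : 1 < |c|) {C : ℝ}
    (hC : ∀ q, |ψ q| ≤ C) (hcont : Continuous ψ) : (N ⧸ Γ) ≃ₜ (N ⧸ Γ) where
  toFun := conjMap L v c ψ
  invFun q := centralExp (-conjCocycle L c ψ q • v) • q
  left_inv q := by
    simp only [conjMap, conjCocycle_centralExp_smul hv hψ, ← centralExp_add_smul, ← add_smul]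
    simp
  right_inv q := by
    simp only [conjMap, conjCocycle_centralExp_smul hv hψ, ← centralExp_add_smul, ← add_smul]
    simp
  continuous_toFun := continuous_centralExp_smul
    ((continuous_conjCocycle hc hC hcont).smul continuous_const) continuous_id
  continuous_invFun := continuous_centralExp_smul
    ((continuous_conjCocycle hc hC hcont).neg.smul continuous_const) continuous_id

theorem contMDiff_centralExp_smul_smul {I' : Type*} [NormedAddCommGroup I'] [NormedSpace ℝ I']
    {H : Type*} [TopologicalSpace H] {J : ModelWithCorners ℝ I' H} {P : Type*} [TopologicalSpace P]
    [ChartedSpace H P] {n : ℕ∞ω} (hn : n ≤ ∞) {a : P → ℝ} {F : P → N ⧸ Γ}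
    (ha : ContMDiff J 𝓘(ℝ, ℝ) n a) (hF : ContMDiff J 𝓘(ℝ, E) n F) (v : centralLie E N) :
    ContMDiff J 𝓘(ℝ, E) n (fun q ↦ centralExp (a q • v) • F q) := by
  have h1 : ContMDiff 𝓘(ℝ, ℝ) 𝓘(ℝ, centralLie E N) n (fun t : ℝ ↦ t • v) :=
    ContDiff.contMDiff (by fun_prop)
  exact (contMDiff_centralExp_smul.of_le hn).comp ((h1.comp ha).prodMk hF)

theorem contMDiff_perturb (hψ : ContMDiff 𝓘(ℝ, E) 𝓘(ℝ, ℝ) ∞ ψ) :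
    ContMDiff 𝓘(ℝ, E) 𝓘(ℝ, E) ∞ (perturb L v ψ) :=
  contMDiff_centralExp_smul_smul le_rfl hψ (contMDiff_quotientEquiv L) v

/-- The perturbation along an eigenvector is a diffeomorphism. -/
def perturbDiffeo (hv : L.centralMap v = c • v) (hc : c ≠ 0)
    (hψ : ∀ (s : ℝ) q, ψ (centralExp (s • v) • q) = ψ q)
    (hsm : ContMDiff 𝓘(ℝ, E) 𝓘(ℝ, ℝ) ∞ ψ) :
    (N ⧸ Γ) ≃ₘ^1⟮𝓘(ℝ, E), 𝓘(ℝ, E)⟯ (N ⧸ Γ) where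
  toFun := perturb L v ψ
  invFun q := L.quotientEquiv.symm
    (centralExp (-ψ (L.quotientEquiv.symm q) • v) • q)
  left_inv q := by
    -- `L⁻¹ (g q)` lies on the `v`-orbit of `q`, so `ψ` takes the same value there and the
    -- displacement can be undone.
    have h : L.quotientEquiv.symm (perturb L v ψ q) = centralExp ((c⁻¹ * ψ q) • v) • q := by
      rw [Equiv.symm_apply_eq, L.quotientEquiv_centralExp_smul, map_smul, hv, smul_smul, perturb]
      congr 3
      field_simp
    simp only [h, hψ]
    rw [perturb, ← centralExp_add_smul, ← add_smul]
    simp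
  right_inv q := by
    have h : L.quotientEquiv.symm (centralExp (-ψ (L.quotientEquiv.symm q) • v) • q) =
        centralExp ((c⁻¹ * -ψ (L.quotientEquiv.symm q)) • v) • L.quotientEquiv.symm q := by
      rw [Equiv.symm_apply_eq, L.quotientEquiv_centralExp_smul, map_smul, hv, smul_smul,
        Equiv.apply_symm_apply]
      congr 3
      field_simp
    change centralExp (ψ (L.quotientEquiv.symm _) • v) • L.quotientEquiv (L.quotientEquiv.symm _) = _
    rw [Equiv.apply_symm_apply, h, hψ, ← centralExp_add_smul, ← add_smul]
    simp
  contMDiff_toFun := (contMDiff_perturb hsm).of_le (by simp)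
  contMDiff_invFun := by
    have h1 : ContMDiff 𝓘(ℝ, E) 𝓘(ℝ, E) 1 L.quotientEquiv.symm := L.quotientDiffeo.symm.contMDiff
    have h2 : ContMDiff 𝓘(ℝ, E) 𝓘(ℝ, ℝ) 1 (fun q ↦ -ψ (L.quotientEquiv.symm q)) :=
      ((hsm.of_le (by simp)).comp h1).neg
    exact h1.comp (contMDiff_centralExp_smul_smul (by simp) h2 contMDiff_id v)

end Perturbation

/-! ## Convergence in the `C^1` topology -/

section C1Topology

open Bundle

variable {E : Type*} [NormedAddCommGroup E] [NormedSpace ℝ E]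
  {M : Type*} [TopologicalSpace M] [ChartedSpace E M] [IsManifold 𝓘(ℝ, E) ∞ M]

/-- The tangent map of a slice is the tangent map of the whole family on vectors with zero parameter
component, hence continuous jointly with the parameter. -/
theorem continuous_tangentMap_param {G : ℝ × M → M}
    (hG : ContMDiff (𝓘(ℝ, ℝ).prod 𝓘(ℝ, E)) 𝓘(ℝ, E) ∞ G) :
    Continuous (fun p : ℝ × TangentBundle 𝓘(ℝ, E) M ↦
      tangentMap 𝓘(ℝ, E) 𝓘(ℝ, E) (fun q ↦ G (p.1, q)) p.2) := by
  have h1 : Continuous (tangentMap (𝓘(ℝ, ℝ).prod 𝓘(ℝ, E)) 𝓘(ℝ, E) G) :=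
    hG.continuous_tangentMap (by simp)
  have h2 : Continuous (equivTangentBundleProd 𝓘(ℝ, ℝ) ℝ 𝓘(ℝ, E) M).symm :=
    (contMDiff_equivTangentBundleProd_symm (I := 𝓘(ℝ, ℝ)) (M := ℝ) (I' := 𝓘(ℝ, E)) (M' := M)
      (n := 0)).continuous
  have h3 : Continuous (fun t : ℝ ↦ (⟨t, 0⟩ : TangentBundle 𝓘(ℝ, ℝ) ℝ)) :=
    (contMDiff_zeroSection (IB := 𝓘(ℝ, ℝ)) ℝ (TangentSpace 𝓘(ℝ, ℝ) : ℝ → Type _) (n := 0)).continuous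
  refine (h1.comp (h2.comp ((h3.comp continuous_fst).prodMk continuous_snd))).congr fun p ↦ ?_
  have h4 : MDifferentiableAt 𝓘(ℝ, E) (𝓘(ℝ, ℝ).prod 𝓘(ℝ, E)) (fun q : M ↦ (p.1, q)) p.2.1 :=
    mdifferentiableAt_const.prodMk mdifferentiableAt_id
  have h5 := tangentMap_comp_at p.2 (hG.mdifferentiableAt (by simp)) h4
  have h6 : (fun q : M ↦ G (p.1, q)) = G ∘ fun q : M ↦ (p.1, q) := rfl
  rw [h6, h5, tangentMap_prod_right]
  rfl

/-- A smooth one-parameter family of diffeomorphisms is continuous in the `C^1` topology. -/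
theorem tendsto_c1Topology {g : ℝ → M ≃ₘ^1⟮𝓘(ℝ, E), 𝓘(ℝ, E)⟯ M}
    (hG : ContMDiff (𝓘(ℝ, ℝ).prod 𝓘(ℝ, E)) 𝓘(ℝ, E) ∞ (fun p : ℝ × M ↦ g p.1 p.2)) (t₀ : ℝ) :
    Tendsto g (𝓝 t₀) (@nhds _ (c1Topology (E := E) (M := M)) (g t₀)) := by
  rw [nhds_induced, tendsto_comap_iff]
  refine Continuous.tendsto (f := _ ∘ g) ?_ t₀
  exact ContinuousMap.continuous_of_continuous_uncurry _ (continuous_tangentMap_param hG)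

end C1Topology

/-! ## Periodic data of the perturbation -/

section PeriodicData

variable {E : Type*} [NormedAddCommGroup E] [NormedSpace ℝ E] [FiniteDimensional ℝ E]
  {N : Type*} [TopologicalSpace N] [ChartedSpace E N] [Group N]
  [LieGroup 𝓘(ℝ, E) ∞ N] {Γ : Subgroup N} [DiscreteTopology Γ]

/-- In the frames given by the orbit maps, a map has the derivative `A`. -/
def HasFrameDeriv (g : N ⧸ Γ → N ⧸ Γ) (q : N ⧸ Γ) (A : E →ₗ[ℝ] E) : Prop :=
  ∃ D : E →L[ℝ] E, HasModelDeriv g q D ∧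
    ∀ X, D (orbitDeriv (E := E) q X) = orbitDeriv (E := E) (g q) (A X)

theorem HasFrameDeriv.comp {f g : N ⧸ Γ → N ⧸ Γ} {q : N ⧸ Γ} {A B : E →ₗ[ℝ] E}
    (hf : HasFrameDeriv f (g q) A) (hg : HasFrameDeriv g q B) :
    HasFrameDeriv (fun x ↦ f (g x)) q (A * B) := by
  obtain ⟨C, hC, hC'⟩ := hf
  obtain ⟨D, hD, hD'⟩ := hg
  refine ⟨C.comp D, hC.comp hD rfl, fun X ↦ ?_⟩
  rw [ContinuousLinearMap.comp_apply, hD', hC', Module.End.mul_apply]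

theorem hasFrameDeriv_id (q : N ⧸ Γ) : HasFrameDeriv (fun x ↦ x) q (1 : E →ₗ[ℝ] E) :=
  ⟨_, hasModelDeriv_id q, fun _ ↦ rfl⟩

/-- Differentiate both sides of `h` at `y = 1`. The orbit frames thus reduce derivatives on the
quotient to derivatives at the identity of `N`. -/
theorem hasFrameDeriv_of_lift {g : N ⧸ Γ → N ⧸ Γ} (hg : ContMDiff 𝓘(ℝ, E) 𝓘(ℝ, E) ∞ g)
    {q : N ⧸ Γ} {β : N → N} {A : E →L[ℝ] E} (hβ : HasModelDeriv β 1 A) (hβ1 : β 1 = 1)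
    (h : ∀ y, g (y • q) = β y • g q) : HasFrameDeriv g q (A : E →ₗ[ℝ] E) := by
  have hD := (hg q).hasModelDeriv (by simp)
  refine ⟨_, hD, fun X ↦ ?_⟩
  have h1 := hD.comp (hasModelDeriv_orbit (E := E) q) (one_smul N q)
  have h2 := (hasModelDeriv_orbit (E := E) (g q)).comp hβ hβ1
  simp only [h] at h1
  exact congrArg (fun C : E →L[ℝ] E ↦ C X) (h1.unique h2)

theorem hasFrameDeriv_quotientEquiv (L : LatticeAut E Γ) (q : N ⧸ Γ) :
    HasFrameDeriv L.quotientEquiv q (L.modelDifferential : E →ₗ[ℝ] E) :=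
  hasFrameDeriv_of_lift (contMDiff_quotientEquiv L) L.hasModelDeriv (map_one _)
    fun y ↦ L.quotientEquiv_smul y q

theorem hasFrameDeriv_iterate_quotientEquiv (L : LatticeAut E Γ) (n : ℕ) (q : N ⧸ Γ) :
    HasFrameDeriv L.quotientEquiv^[n] q ((L.modelDifferential : E →ₗ[ℝ] E) ^ n) := by
  induction n with
  | zero => exact hasFrameDeriv_id q
  | succ n ih =>
    rw [pow_succ', iterate_succ']
    exact (hasFrameDeriv_quotientEquiv L _).comp ih

variable [T2Space N] {L : LatticeAut E Γ} {v : centralLie E N} {c : ℝ} {ψ : N ⧸ Γ → ℝ}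

theorem hasFrameDeriv_perturb (hsm : ContMDiff 𝓘(ℝ, E) 𝓘(ℝ, ℝ) ∞ ψ)
    (hψ : ∀ (s : ℝ) q, ψ (centralExp (s • v) • q) = ψ q) (q : N ⧸ Γ) :
    ∃ ℓ : E →ₗ[ℝ] ℝ, ℓ v = 0 ∧ HasFrameDeriv (perturb L v ψ) q
      ((L.modelDifferential : E →ₗ[ℝ] E) + ℓ.smulRight (v : E)) := by
  have h1 := ((hsm q).hasModelDeriv (by simp)).comp (hasModelDeriv_orbit (E := E) q) (one_smul N q)
  set ℓ : E →L[ℝ] ℝ := (modelDeriv ψ q : E →L[ℝ] ℝ).comp (orbitDeriv (E := E) q : E →L[ℝ] E)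
  have hℓv : ℓ v = 0 := by
    have h2 := h1.comp (isCentralFlow_centralExp v).hasModelDeriv (by simp)
    simp only [hψ] at h2
    have h3 : HasModelDeriv (fun _ : ℝ ↦ ψ q) (0 : ℝ) (0 : ℝ →L[ℝ] ℝ) := by
      rw [hasModelDeriv_iff_hasFDerivAt]
      exact hasFDerivAt_const _ _
    have h4 := congrArg (fun C : ℝ →L[ℝ] ℝ ↦ C 1) (h2.unique h3)
    simpa using h4
  refine ⟨ℓ, hℓv, ?_⟩
  -- Subtracting `ψ q` makes the value `1` at the base point, where the derivative of a product is a
  -- sum.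
  have h2 : HasModelDeriv (fun t : ℝ ↦ centralExp ((t - ψ q) • v)) (ψ q)
      (ContinuousLinearMap.toSpanSingleton ℝ (v : E)) := by
    have h3 : HasModelDeriv (fun t : ℝ ↦ t - ψ q) (ψ q) (ContinuousLinearMap.id ℝ ℝ) := by
      rw [hasModelDeriv_iff_hasFDerivAt]
      exact (hasFDerivAt_id _).sub_const _
    exact (isCentralFlow_centralExp v).hasModelDeriv.comp h3 (sub_self _)
  have h3 := h2.comp h1 (by rw [one_smul])
  have h4 := L.hasModelDeriv.mul_of_eq_one h3 (map_one _) (by simp)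
  have h5 := hasFrameDeriv_of_lift (contMDiff_perturb (L := L) (v := v) hsm) h4 (by simp)
    (q := q) (fun y ↦ by
      rw [perturb, perturb, L.quotientEquiv_smul, ← centralExp_mul_comm, mul_smul,
        ← centralExp_smul_comm, ← centralExp_add_smul, ← add_smul]
      simp)
  convert h5 using 1
  ext X
  simp

/-- Operators `A^n + v ⊗ ℓ` with `ℓ v = 0` are stable under composition with `A + v ⊗ m`, `m v = 0`,
because `v` is an eigenvector of `A`. -/
theorem hasFrameDeriv_iterate_perturb (hv : L.centralMap v = c • v)
    (hsm : ContMDiff 𝓘(ℝ, E) 𝓘(ℝ, ℝ) ∞ ψ)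
    (hψ : ∀ (s : ℝ) q, ψ (centralExp (s • v) • q) = ψ q) (n : ℕ) (q : N ⧸ Γ) :
    ∃ ℓ : E →ₗ[ℝ] ℝ, ℓ v = 0 ∧ HasFrameDeriv (perturb L v ψ)^[n] q
      ((L.modelDifferential : E →ₗ[ℝ] E) ^ n + ℓ.smulRight (v : E)) := by
  have hv' : L.modelDifferential (v : E) = c • (v : E) := congrArg Subtype.val hv
  induction n with
  | zero => exact ⟨0, rfl, by
      rw [pow_zero, LinearMap.zero_smulRight, add_zero]
      exact hasFrameDeriv_id q⟩
  | succ n ih =>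
    obtain ⟨ℓ, hℓ, h⟩ := ih
    obtain ⟨m, hm, h'⟩ := hasFrameDeriv_perturb (L := L) hsm hψ ((perturb L v ψ)^[n] q)
    have hpow : ((L.modelDifferential : E →ₗ[ℝ] E) ^ n) (v : E) = c ^ n • (v : E) := by
      clear h h'
      induction n with
      | zero => simp
      | succ n ih =>
        rw [pow_succ', Module.End.mul_apply, ih, map_smul, ContinuousLinearMap.coe_coe, hv',
          smul_smul, pow_succ]
    refine ⟨c • ℓ + m ∘ₗ ((L.modelDifferential : E →ₗ[ℝ] E) ^ n), ?_, ?_⟩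
    · simp [hℓ, hpow, hm]
    · rw [iterate_succ']
      have heq : (L.modelDifferential : E →ₗ[ℝ] E) ^ (n + 1) +
          (c • ℓ + m ∘ₗ ((L.modelDifferential : E →ₗ[ℝ] E) ^ n)).smulRight (v : E) =
          ((L.modelDifferential : E →ₗ[ℝ] E) + m.smulRight (v : E)) *
            ((L.modelDifferential : E →ₗ[ℝ] E) ^ n + ℓ.smulRight (v : E)) := ?_
      · exact heq ▸ h'.comp h
      refine LinearMap.ext fun X ↦ ?_
      simp only [LinearMap.add_apply, LinearMap.smulRight_apply, LinearMap.smul_apply,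
        Module.End.mul_apply, map_add, map_smul, hm, ContinuousLinearMap.coe_coe, hv', pow_succ',
        LinearMap.comp_apply]
      module

theorem samePeriodicData_perturb {ι : Type*} {b : Module.Basis ι ℝ E} {l : ι → ℝ}
    (hA : ∀ i, L.modelDifferential (b i) = l i • b i) (hl : Injective (fun i ↦ |l i|)) (i : ι)
    (hvi : (v : E) = b i) (hsm : ContMDiff 𝓘(ℝ, E) 𝓘(ℝ, ℝ) ∞ ψ)
    (hψ : ∀ (s : ℝ) q, ψ (centralExp (s • v) • q) = ψ q) {h : N ⧸ Γ → N ⧸ Γ}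
    (hconj : ∀ q, L.quotientEquiv (h q) = h (perturb L v ψ q)) :
    SamePeriodicData (E := E) L.quotientEquiv (perturb L v ψ) h := by
  intro p n hn hp
  have hv : L.centralMap v = l i • v := Subtype.ext (by
    rw [L.coe_centralMap, Submodule.coe_smul, hvi, hA])
  have hp' : L.quotientEquiv^[n] (h p) = h p := by
    have : ∀ n, L.quotientEquiv^[n] (h p) = h ((perturb L v ψ)^[n] p) := by
      intro n
      induction n with
      | zero => rfl
      | succ n ih => rw [iterate_succ_apply', iterate_succ_apply', ih, hconj]
    rw [this, hp]
  obtain ⟨ℓ, hℓ, D, hD, hD'⟩ := hasFrameDeriv_iterate_perturb (L := L) hv hsm hψ n p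
  obtain ⟨C, hC, hC'⟩ := hasFrameDeriv_iterate_quotientEquiv L n (h p)
  obtain ⟨P, hP⟩ := exists_conj_pow_add_smulRight (A := (L.modelDifferential : E →ₗ[ℝ] E))
    hA hl i ℓ (hvi ▸ hℓ) hn
  rw [hp'] at hC'
  rw [hp] at hD'
  have hcomm : ∀ X : E, orbitDeriv (E := E) (h p) (P ((orbitDeriv (E := E) p).symm (D X))) =
      C (orbitDeriv (E := E) (h p) (P ((orbitDeriv (E := E) p).symm X))) := by
    intro X
    obtain ⟨Y, rfl⟩ := (orbitDeriv (E := E) p).surjective X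
    rw [hD', ContinuousLinearEquiv.symm_apply_apply, ContinuousLinearEquiv.symm_apply_apply, hC',
      ← hP, LinearMap.add_apply, LinearMap.smulRight_apply, hvi]
  have hDeq := hD.modelDeriv_eq
  have hCeq := hC.modelDeriv_eq
  rw [← hDeq, ← hCeq] at hcomm
  exact ⟨((orbitDeriv (E := E) p).symm.trans P.toContinuousLinearEquiv).trans
    (orbitDeriv (E := E) (h p)), hcomm⟩

end PeriodicData

/-! ## The conjugacy is not differentiable -/

section NotDifferentiable

open Asymptotics

variable {E : Type*} [NormedAddCommGroup E] [NormedSpace ℝ E]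
  {N : Type*} [TopologicalSpace N] [ChartedSpace E N] [Group N] {Γ : Subgroup N}
  {L : LatticeAut E Γ} {c d : ℝ} {ψ : N ⧸ Γ → ℝ}

theorem LatticeAut.iterate_quotientEquiv_one (L : LatticeAut E Γ) (k : ℕ) :
    L.quotientEquiv^[k] ((1 : N) : N ⧸ Γ) = ((1 : N) : N ⧸ Γ) := by
  refine iterate_fixed ?_ k
  rw [L.quotientEquiv_mk, map_one]

theorem conjCocycle_one (hψ : ψ ((1 : N) : N ⧸ Γ) = 0) :
    conjCocycle L c ψ ((1 : N) : N ⧸ Γ) = 0 := by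
  simp [conjCocycle, L.iterate_quotientEquiv_one, hψ]

/-- The first term, of size `|ψ q| / |c|`, outweighs the geometric tail once the `K` terms after it
vanish. `K` depends only on `c`, so it is fixed before `ψ` is constructed and is unaffected by
scaling `ψ`. -/
theorem exists_forall_conjCocycle_ne_zero (hc : 1 < |c|) : ∃ K : ℕ, ∀ (L : LatticeAut E Γ)
    (ψ : N ⧸ Γ → ℝ) (q : N ⧸ Γ), ψ q ≠ 0 → (∀ x, |ψ x| ≤ |ψ q|) →
    (∀ k < K, ψ (L.quotientEquiv^[k + 1] q) = 0) → conjCocycle L c ψ q ≠ 0 := by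
  set r := |c|⁻¹ with hr
  have hr0 : 0 < r := by positivity
  have hr1 : r < 1 := inv_lt_one_of_one_lt₀ hc
  -- With `r^K < 1 - r` the tail is at most `r^(K+2) |ψ q| / (1 - r) < r |ψ q|`.
  obtain ⟨K, hK⟩ := exists_pow_lt_of_lt_one (sub_pos.2 hr1) hr1
  refine ⟨K, fun L ψ q hq hC hzero h0 ↦ ?_⟩
  have hs := summable_conjCocycle (L := L) hc hC q
  have hsplit := hs.sum_add_tsum_nat_add (K + 1)
  have hfin : ∑ k ∈ Finset.range (K + 1), (c ^ (k + 1))⁻¹ * ψ (L.quotientEquiv^[k] q) =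
      c⁻¹ * ψ q := by
    rw [Finset.sum_range_succ', Finset.sum_eq_zero]
    · simp
    · intro k hk
      rw [hzero k (Finset.mem_range.1 hk), mul_zero]
  rw [← conjCocycle, h0, hfin] at hsplit
  have hgeo : HasSum (fun k : ℕ ↦ r ^ (k + (K + 1) + 1) * |ψ q|)
      (r ^ (K + 2) * |ψ q| * (1 - r)⁻¹) := by
    have := (hasSum_geometric_of_lt_one hr0.le hr1).mul_left (r ^ (K + 2) * |ψ q|)
    refine this.congr_fun ?_ |> fun h ↦ h
    intro k
    ring
  have hbound := tsum_of_norm_bounded hgeo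
    (fun k ↦ norm_conjCocycle_term_le (L := L) (c := c) hC (k + (K + 1)) q)
  have hlt : r ^ (K + 2) * |ψ q| * (1 - r)⁻¹ < r * |ψ q| := by
    have h1 : 0 < |ψ q| := abs_pos.2 hq
    have h2 : 0 < 1 - r := sub_pos.2 hr1
    rw [← div_eq_mul_inv, div_lt_iff₀ h2]
    have h3 : r ^ (K + 2) ≤ r * (r ^ K) := by
      rw [← pow_succ']
      exact pow_le_pow_of_le_one hr0.le hr1.le (by omega)
    calc r ^ (K + 2) * |ψ q| ≤ r * (r ^ K) * |ψ q| := by gcongr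
      _ < r * (1 - r) * |ψ q| := by gcongr
      _ = _ := by ring
  have habs : ‖c⁻¹ * ψ q‖ = r * |ψ q| := by rw [norm_mul, norm_inv, Real.norm_eq_abs,
    Real.norm_eq_abs]
  rw [eq_neg_of_add_eq_zero_left hsplit, norm_neg] at habs
  linarith

variable [LieGroup 𝓘(ℝ, E) ∞ N] [T2Space N] [FiniteDimensional ℝ E] [DiscreteTopology Γ]
  {v w : centralLie E N}

/-- On the `w`-orbit of the base point `h` is `exp (s w) ↦ exp (F s v + s w)`. Along `s = d^(-k) t₀`
the value `F s` decays only like `c^(-k)`, contradicting the bound `O(s)` implied by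
differentiability. -/
theorem not_hasModelDeriv_conjMap (hv0 : v ≠ 0) (hw : L.centralMap w = d • w) (hc : 1 < |c|)
    (hcd : |c| < |d|) {C : ℝ} (hC : ∀ q, |ψ q| ≤ C) (hψ1 : ψ ((1 : N) : N ⧸ Γ) = 0) {t₀ : ℝ}
    (hneg : ∀ k : ℕ, ψ (centralExp (((d ^ (k + 1))⁻¹ * t₀) • w) • ((1 : N) : N ⧸ Γ)) = 0)
    (ht₀ : conjCocycle L c ψ (centralExp (t₀ • w) • ((1 : N) : N ⧸ Γ)) ≠ 0) (A : E →L[ℝ] E) :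
    ¬ HasModelDeriv (conjMap L v c ψ) ((1 : N) : N ⧸ Γ) A := by
  intro hA
  have hc0 : c ≠ 0 := by rintro rfl; norm_num at hc
  have hd1 : 1 < |d| := hc.trans hcd
  have hd0 : d ≠ 0 := by rintro rfl; norm_num at hd1
  set o : N ⧸ Γ := ((1 : N) : N ⧸ Γ) with ho
  set F : ℝ → ℝ := fun s ↦ conjCocycle L c ψ (centralExp (s • w) • o) with hF
  set t : ℕ → ℝ := fun k ↦ (d ^ k)⁻¹ * t₀ with ht
  have hstep : ∀ s, c * F s = ψ (centralExp (s • w) • o) + F (d * s) := by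
    intro s
    have h1 := mul_conjCocycle (L := L) hc hC (centralExp (s • w) • o)
    rw [L.quotientEquiv_centralExp_smul, map_smul, hw, smul_smul, mul_comm s] at h1
    have h2 : L.quotientEquiv o = o := L.iterate_quotientEquiv_one 1
    rwa [h2] at h1
  have hFt : ∀ k, F (t k) = (c⁻¹) ^ k * F t₀ := by
    intro k
    induction k with
    | zero => simp [ht]
    | succ k ih =>
      have h1 := hstep (t (k + 1))
      have h2 : d * t (k + 1) = t k := by simp only [ht, pow_succ]; field_simp
      rw [hneg k, zero_add, h2, ih] at h1
      rw [pow_succ', mul_assoc, ← h1]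
      field_simp
  have ht_lim : Tendsto t atTop (𝓝 0) := by
    have h1 : |d⁻¹| < 1 := by rw [abs_inv]; exact inv_lt_one_of_one_lt₀ hd1
    have h2 := (tendsto_pow_atTop_nhds_zero_of_abs_lt_one h1).mul_const t₀
    simpa only [ht, inv_pow, zero_mul] using h2
  have hFt_lim : Tendsto (fun k ↦ F (t k)) atTop (𝓝 0) := by
    have h1 : |c⁻¹| < 1 := by rw [abs_inv]; exact inv_lt_one_of_one_lt₀ hc
    have h2 := (tendsto_pow_atTop_nhds_zero_of_abs_lt_one h1).mul_const (F t₀)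
    simpa only [hFt, zero_mul] using h2
  set X : ℕ → centralLie E N := fun k ↦ F (t k) • v + t k • w with hX
  have hX_lim : Tendsto X atTop (𝓝 0) := by
    simpa using (hFt_lim.smul_const v).add (ht_lim.smul_const w)
  have hconj : ∀ s, conjMap L v c ψ (centralExp (s • w) • o) =
      centralExp (F s • v + s • w) • o := fun s ↦ by
    rw [centralExp_add_smul]; rfl
  have hF0 : F 0 = 0 := by
    simp only [hF, zero_smul, centralExp_zero, one_smul]
    exact conjCocycle_one hψ1
  have hconj0 : conjMap L v c ψ (centralExp ((0 : ℝ) • w) • o) = o := by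
    rw [hconj, hF0]; simp
  -- Injectivity of the derivative of the central orbit map bounds the logarithms `X k` by the chart
  -- displacement; differentiability of `h` then bounds that displacement by `t k`.
  have hO1 : X =O[atTop] fun k ↦ chartAt E o (centralExp (X k) • o) - chartAt E o o := by
    have h1 := (hasModelDeriv_centralExp_smul (E := E) o).isBigO_sub_rev
      ((orbitDeriv (E := E) o).injective.comp Subtype.val_injective)
    simp only [centralExp_zero, one_smul, sub_zero] at h1
    exact h1.comp_tendsto hX_lim
  have hO2 : (fun k ↦ chartAt E o (centralExp (X k) • o) - chartAt E o o) =O[atTop] t := by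
    have h1 : HasModelDeriv (fun s : ℝ ↦ s • w) (0 : ℝ)
        (ContinuousLinearMap.toSpanSingleton ℝ w) := by
      rw [hasModelDeriv_iff_hasFDerivAt]
      exact (ContinuousLinearMap.toSpanSingleton ℝ w).hasFDerivAt
    have h2 := (hasModelDeriv_centralExp_smul (E := E) o).comp h1 (zero_smul ℝ w)
    have h3 := hA.comp h2 (by simp)
    have h4 := h3.hasFDerivAt_chart.isBigO_sub
    simp only [hconj0, sub_zero] at h4
    have h5 := h4.comp_tendsto ht_lim
    simp only [comp_def, hconj] at h5
    exact h5
  have hO3 : (fun k ↦ F (t k) • v) =O[atTop] t := by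
    have h1 : (fun k ↦ t k • w) =O[atTop] t :=
      IsBigO.of_bound ‖w‖ (Eventually.of_forall fun k ↦ by rw [norm_smul, mul_comm])
    refine ((hO1.trans hO2).sub h1).congr_left fun k ↦ ?_
    simp [hX]
  have hO4 : (fun k : ℕ ↦ (c⁻¹) ^ k) =O[atTop] fun k ↦ (d⁻¹) ^ k := by
    have h1 : (fun k : ℕ ↦ (c⁻¹) ^ k) =O[atTop] fun k ↦ F (t k) • v := by
      refine IsBigO.of_bound (|F t₀| * ‖v‖)⁻¹ (Eventually.of_forall fun k ↦ ?_)
      have h2 : |F t₀| * ‖v‖ ≠ 0 := mul_ne_zero (abs_ne_zero.2 ht₀) (norm_ne_zero_iff.2 hv0)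
      rw [norm_smul, hFt, norm_mul, Real.norm_eq_abs (F t₀)]
      rw [mul_assoc, mul_left_comm, inv_mul_cancel₀ h2, mul_one]
    refine (h1.trans hO3).trans (IsBigO.of_bound |t₀| (Eventually.of_forall fun k ↦ ?_))
    simp only [ht]
    rw [norm_mul, inv_pow, mul_comm, Real.norm_eq_abs t₀]
  have hlo : (fun k : ℕ ↦ (d⁻¹) ^ k) =o[atTop] fun k ↦ (c⁻¹) ^ k := by
    refine isLittleO_pow_pow_of_abs_lt_left ?_
    rw [abs_inv, abs_inv]
    exact inv_strictAnti₀ (by positivity) hcd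
  refine isLittleO_irrefl ?_ (hO4.trans_isLittleO hlo)
  exact Frequently.of_forall fun k ↦ pow_ne_zero k (inv_ne_zero hc0)

end NotDifferentiable

/-! ## The choice of the perturbation -/

section Choice

/-- As `d ^ m ≠ 1` for `m ≠ 0`, each condition excludes only countably many `t`. -/
theorem exists_notMem_countable_of_one_lt_abs {T : Set ℝ} (hT : T.Countable) {d : ℝ}
    (hd : 1 < |d|) : ∃ t, t ∉ T ∧ ∀ m : ℤ, m ≠ 0 → (1 - d ^ m) * t ∉ T := by
  have hbad : (T ∪ ⋃ m : {m : ℤ // m ≠ 0}, (fun t ↦ (1 - d ^ (m : ℤ)) * t) ⁻¹' T).Countable := by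
    refine hT.union (countable_iUnion fun m ↦ hT.preimage_of_injOn (Injective.injOn ?_))
    refine mul_right_injective₀ ?_
    rw [sub_ne_zero]
    intro h
    have h1 : |d| ^ (m : ℤ) = 1 := by rw [← abs_zpow, ← h, abs_one]
    exact m.2 ((zpow_eq_one_iff_right₀ (abs_nonneg d) hd.ne').1 h1)
  obtain ⟨t, ht⟩ := (hbad.dense_compl ℝ).nonempty
  simp only [mem_compl_iff, mem_union, mem_iUnion, not_or, not_exists, mem_preimage] at ht
  exact ⟨t, ht.1, fun m hm ↦ ht.2 ⟨m, hm⟩⟩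

variable {E : Type*} [NormedAddCommGroup E] [NormedSpace ℝ E]
  {N : Type*} [TopologicalSpace N] [T2Space N] [ChartedSpace E N] [Group N]
  [LieGroup 𝓘(ℝ, E) ∞ N] {Γ : Subgroup N}

theorem centralExp_sub_mem_of_smul_eq {X Y : centralLie E N}
    (h : centralExp X • ((1 : N) : N ⧸ Γ) = centralExp Y • ((1 : N) : N ⧸ Γ)) :
    centralExp (X - Y) ∈ Γ := by
  have h1 : ((centralExp X * 1 : N) : N ⧸ Γ) = ((centralExp Y * 1 : N) : N ⧸ Γ) := h
  rw [mul_one, mul_one] at h1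
  have h2 := QuotientGroup.eq.1 h1.symm
  rwa [← centralExp_neg, ← centralExp_add, neg_add_eq_sub] at h2

variable [FiniteDimensional ℝ E]

/-- A real subspace spanned by logarithms of lattice elements has a finite family of generators
of this form. -/
theorem exists_lattice_generators {S : Submodule ℝ E}
    (hS : S ≤ Submodule.span ℝ ((S : Set E) ∩ centralLattice E Γ)) :
    ∃ (k : ℕ) (e : Fin k → centralLie E N), (∀ i, centralExp (e i) ∈ Γ) ∧
      ∀ Y : centralLie E N, Y ∈ Submodule.span ℝ (range e) ↔ (Y : E) ∈ S := by
  obtain ⟨B, hB, hBspan, hBli⟩ := exists_linearIndependent ℝ ((S : Set E) ∩ centralLattice E Γ)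
  have hBfin : B.Finite := hBli.setFinite
  obtain ⟨k, ⟨f⟩⟩ := hBfin.to_subtype.exists_equiv_fin
  have hmem : ∀ i, ∃ h : ((f.symm i : B) : E) ∈ centralLie E N, centralExp ⟨_, h⟩ ∈ Γ :=
    fun i ↦ (hB (f.symm i).2).2
  let e : Fin k → centralLie E N := fun i ↦ ⟨f.symm i, (hmem i).choose⟩
  refine ⟨k, e, fun i ↦ (hmem i).choose_spec, fun Y ↦ ?_⟩
  have hmap : (Submodule.span ℝ (range e)).map (centralLie E N).subtype = S := by
    rw [Submodule.map_span, ← range_comp]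
    have h1 : range ((centralLie E N).subtype ∘ e) = B := by
      have : (centralLie E N).subtype ∘ e = Subtype.val ∘ f.symm := rfl
      rw [this, range_comp, f.symm.range_eq_univ, image_univ, Subtype.range_coe]
    rw [h1, hBspan]
    exact le_antisymm (Submodule.span_le.2 inter_subset_left) hS
  rw [← hmap]
  constructor
  · exact fun h ↦ ⟨Y, h, rfl⟩
  · rintro ⟨Z, hZ, hZY⟩
    rwa [← Subtype.ext (show (Z : E) = Y from hZY)]

/-- The lattice is discrete, hence countable, and since `w ∉ S` the vector `t • w - Y` determines
`t`. -/
theorem countable_setOf_smul_sub_mem [DiscreteTopology Γ] {S : Submodule ℝ (centralLie E N)}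
    {w : centralLie E N} (hw : w ∉ S) :
    {t : ℝ | ∃ Y ∈ S, centralExp (t • w - Y) ∈ Γ}.Countable := by
  have := discreteTopology_of_eventually_eq_zero (eventually_mem_centralLattice (E := E) (Γ := Γ))
  have hcount : Countable (centralLattice E Γ) :=
    TopologicalSpace.separableSpace_iff_countable.1 inferInstance
  set T := {t : ℝ | ∃ Y ∈ S, centralExp (t • w - Y) ∈ Γ}
  have hT : ∀ t : T, ∃ Y ∈ S, centralExp ((t : ℝ) • w - Y) ∈ Γ := fun t ↦ t.2
  choose Y hYS hYΓ using hT
  refine (countable_coe_iff (s := T)).1 (Injective.countable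
    (f := fun t : T ↦ (⟨((t : ℝ) • w - Y t : centralLie E N), mem_centralLattice.2
      ⟨_, hYΓ t⟩⟩ : centralLattice E Γ)) ?_)
  intro s t hst
  have h1 : (s : ℝ) • w - Y s = (t : ℝ) • w - Y t := 
    Subtype.ext (congrArg (fun x : centralLattice E Γ ↦ (x : E)) hst)
  have h2 : ((s : ℝ) - t) • w ∈ S := by
    have : ((s : ℝ) - t) • w = Y s - Y t := by
      rw [sub_smul, sub_eq_sub_iff_sub_eq_sub]; exact h1
    rw [this]
    exact sub_mem (hYS s) (hYS t)
  by_contra hne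
  exact hw ((S.smul_mem_iff (sub_ne_zero.2 fun h ↦ hne (Subtype.ext h))).1 h2)

/-- There is a smooth function on `N ⧸ Γ`, invariant under a rational central subgroup, that
equals one at a point of the orbit of `w` through the base point and vanishes on many of its
iterates. -/
theorem exists_contMDiff_separating_orbit [DiscreteTopology Γ] [CompactSpace (N ⧸ Γ)]
    {S : Submodule ℝ E} (hS : S ≤ Submodule.span ℝ ((S : Set E) ∩ centralLattice E Γ))
    {w : centralLie E N} (hw : (w : E) ∉ S) {d : ℝ} (hd : 1 < |d|) (K : ℕ) :
    ∃ (φ : N ⧸ Γ → ℝ) (t₀ : ℝ), ContMDiff 𝓘(ℝ, E) 𝓘(ℝ, ℝ) ∞ φ ∧ (∀ q, φ q ∈ Icc 0 1) ∧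
      (∀ Y : centralLie E N, (Y : E) ∈ S → ∀ q, φ (centralExp Y • q) = φ q) ∧
      φ ((1 : N) : N ⧸ Γ) = 0 ∧ φ (centralExp (t₀ • w) • ((1 : N) : N ⧸ Γ)) = 1 ∧
      (∀ k : ℕ, φ (centralExp (((d ^ (k + 1))⁻¹ * t₀) • w) • ((1 : N) : N ⧸ Γ)) = 0) ∧
      ∀ k < K, φ (centralExp ((d ^ (k + 1) * t₀) • w) • ((1 : N) : N ⧸ Γ)) = 0 := by
  obtain ⟨n, e, he, hspan⟩ := exists_lattice_generators hS
  have hw' : w ∉ Submodule.span ℝ (range e) := fun h ↦ hw ((hspan w).1 h)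
  obtain ⟨t₀, ht₀, ht₀m⟩ := exists_notMem_countable_of_one_lt_abs
    (countable_setOf_smul_sub_mem (Γ := Γ) hw') hd
  set o : N ⧸ Γ := ((1 : N) : N ⧸ Γ) with ho
  let p : ℝ → N ⧸ Γ := fun s ↦ centralExp (s • w) • o
  have hp : Continuous p := by
    have h1 : Continuous (fun s : ℝ ↦ (s • w, o)) := by fun_prop
    exact (contMDiff_centralExp_smul (E := E) (Γ := Γ)).continuous.comp h1
  have hp0 : p 0 = o := by simp [p]
  have hlim : Tendsto (fun k : ℕ ↦ p ((d ^ (k + 1))⁻¹ * t₀)) atTop (𝓝 (p 0)) := by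
    refine (hp.tendsto 0).comp ?_
    have h1 : |d⁻¹| < 1 := by rw [abs_inv]; exact inv_lt_one_of_one_lt₀ hd
    have h2 := ((tendsto_pow_atTop_nhds_zero_of_abs_lt_one h1).comp
      (tendsto_add_atTop_nat 1)).mul_const t₀
    simpa only [comp_def, inv_pow, zero_mul] using h2
  -- The points where `φ` must vanish: the whole backward orbit with its limit, the base point,
  -- which makes the set compact, and `K` forward iterates.
  let K₀ : Set (N ⧸ Γ) := insert (p 0) (range fun k : ℕ ↦ p ((d ^ (k + 1))⁻¹ * t₀)) ∪
    (fun k : ℕ ↦ p (d ^ (k + 1) * t₀)) '' Iio K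
  have hK₀ : IsCompact K₀ := hlim.isCompact_insert_range.union ((finite_Iio K).image _).isCompact
  have hdisj : Disjoint (centralSaturation (Submodule.span ℝ (range e)) K₀)
      (centralSaturation (Submodule.span ℝ (range e)) {p t₀}) := by
    rw [Set.disjoint_left]
    rintro q ⟨Y, hY, x, hx, rfl⟩ ⟨Z, hZ, y, rfl, hyx⟩
    -- If `p s` and `p t₀` had a common saturation, `t₀ - s` would be in the countable set avoided
    -- by `t₀` and all `(1 - d ^ m) t₀`; here `s` is `0` or `d ^ m t₀`.
    have key : ∀ s, x = p s → t₀ - s ∈ {t : ℝ | ∃ Y ∈ Submodule.span ℝ (range e),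
        centralExp (t • w - Y) ∈ Γ} := by
      rintro s rfl
      simp only [p, ← centralExp_add_smul] at hyx
      have h1 := centralExp_sub_mem_of_smul_eq hyx
      refine ⟨Y - Z, sub_mem hY hZ, ?_⟩
      convert h1 using 2
      rw [sub_smul]
      abel
    rcases hx with (rfl | ⟨k, rfl⟩) | ⟨k, -, rfl⟩
    · exact ht₀ (by simpa using key 0 rfl)
    · refine ht₀m (-(k + 1 : ℕ)) (by omega) ?_
      have := key _ rfl
      rwa [zpow_neg, zpow_natCast, sub_mul, one_mul]
    · refine ht₀m (k + 1 : ℕ) (by omega) ?_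
      have := key _ rfl
      rwa [zpow_natCast, sub_mul, one_mul]
  obtain ⟨φ, hφ, h01, h0, h1, hinv⟩ :=
    exists_contMDiff_invariant (E := E) he hK₀ isCompact_singleton hdisj
  refine ⟨φ, t₀, hφ, h01, fun Y hY ↦ hinv Y ((hspan Y).2 hY), ?_, h1 _ rfl, fun k ↦ ?_,
    fun k hk ↦ ?_⟩
  · rw [← hp0]; exact h0 _ (Or.inl (mem_insert _ _))
  · exact h0 _ (Or.inl (mem_insert_of_mem _ ⟨k, rfl⟩))
  · exact h0 _ (Or.inr ⟨k, hk, rfl⟩)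

end Choice

/-! ## Expanding eigenvectors in the center -/

section ExpandingPair

variable {E : Type*} [NormedAddCommGroup E] [NormedSpace ℝ E]
  {N : Type*} [TopologicalSpace N] [ChartedSpace E N] [Group N] {Γ : Subgroup N}

theorem LatticeAut.modelDifferential_injective (L : LatticeAut E Γ) : Injective L.modelDifferential := by
  have h1 := (L.contMDiff_invFun 1).hasModelDeriv (by simp)
  have h2 := h1.comp L.hasModelDeriv (map_one _)
  simp only [MulEquiv.symm_apply_apply] at h2
  have h3 := h2.unique (hasModelDeriv_id (E := E) (1 : N))
  exact LeftInverse.injective (g := fun X ↦ (modelDeriv L.toMulEquiv.symm (1 : N) : E →L[ℝ] E) X)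
    fun X ↦ congrArg (fun C : E →L[ℝ] E ↦ C X) h3

variable [FiniteDimensional ℝ E] [T2Space N] [LieGroup 𝓘(ℝ, E) ∞ N]

theorem LatticeAut.exists_expanding_central_pair [DiscreteTopology Γ] (L : LatticeAut E Γ)
    (hAnosov : L.IsAnosov) (hSimple : L.HasSimpleSpectrum) (hReducible : L.IsReducibleOnCenter) :
    ∃ (ι : Type) (b : Module.Basis ι ℝ E) (l : ι → ℝ) (i j : ι) (S : Submodule ℝ E),
      (∀ i, L.modelDifferential (b i) = l i • b i) ∧ Injective (fun i ↦ |l i|) ∧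
      1 < |l i| ∧ |l i| < |l j| ∧
      S ≤ Submodule.span ℝ ((S : Set E) ∩ centralLattice E Γ) ∧
      b i ∈ S ∧ b j ∈ Submodule.span ℝ (centralLattice E Γ : Set E) ∧ b j ∉ S := by
  have hS : (((L.modelDifferential : E →ₗ[ℝ] E).charpoly.aroots ℂ).map (‖·‖)).Nodup := hSimple
  obtain ⟨ι, _, b, l, hA, hl, hmem⟩ := exists_eigenbasis_of_nodup_norm _ hS
  have h1 : ∀ i, |l i| ≠ 1 := by
    intro i
    have : ‖(l i : ℂ)‖ ≠ 1 := hAnosov _ (hmem i)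
    rwa [Complex.norm_real] at this
  have h0 : ∀ i, l i ≠ 0 := by
    intro i hi
    refine b.ne_zero i (L.modelDifferential_injective ?_)
    rw [map_zero]
    have := hA i
    rwa [hi, zero_smul] at this
  obtain ⟨W, hW0, hWV, hAW⟩ := hReducible
  let : Module ℚ E := groupLieAlgebraRatModule (E := E) (N := N)
  have hWV' : (show Submodule ℚ E from W) < Submodule.span ℚ (centralLattice E Γ : Set E) := by
    rw [coe_centralLattice]
    exact hWV
  obtain ⟨i, j, S, h⟩ := exists_expanding_pair hA hl h1 h0
    (eventually_mem_centralLattice (E := E) (Γ := Γ)) (fun X hX ↦ L.modelDifferential_mem hX)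
    (W := W) hW0 hWV' hAW
  exact ⟨ι, b, l, i, j, S, hA, hl, h.1, h.2.1, h.2.2.1, h.2.2.2.2⟩

end ExpandingPair

end

theorem proposition8p2 {E : Type*} [NormedAddCommGroup E] [NormedSpace ℝ E]
    [FiniteDimensional ℝ E]
    {N : Type*} [TopologicalSpace N] [T2Space N] [ConnectedSpace N] [ChartedSpace E N] [Group N]
    [LieGroup 𝓘(ℝ, E) ∞ N] [Group.IsNilpotent N]
    (Γ : Subgroup N) [DiscreteTopology Γ] [CompactSpace (N ⧸ Γ)]
    (L : LatticeAut E Γ) (hAnosov : L.IsAnosov) (hSimple : L.HasSimpleSpectrum)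
    (hReducible : L.IsReducibleOnCenter) :
    ¬ LocallyPeriodicDataRigid (E := E) L.quotientDiffeo := by
  obtain ⟨ι, b, l, i, j, S, hA, hl, hi1, hij, hS, hiS, hjΛ, hjS⟩ :=
    L.exists_expanding_central_pair hAnosov hSimple hReducible
  have hΛ : Submodule.span ℝ (centralLattice E Γ : Set E) ≤ centralLie E N :=
    Submodule.span_le.2 fun X hX ↦ hX.1
  let v : centralLie E N := ⟨b i, hΛ (Submodule.span_mono inter_subset_right (hS hiS))⟩
  let w : centralLie E N := ⟨b j, hΛ hjΛ⟩
  have hv : L.centralMap v = l i • v := Subtype.ext (hA i)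
  have hw : L.centralMap w = l j • w := Subtype.ext (hA j)
  have hv0 : v ≠ 0 := fun h ↦ b.ne_zero i (congrArg Subtype.val h)
  have hli : l i ≠ 0 := by intro h; rw [h] at hi1; norm_num at hi1
  obtain ⟨K, hK⟩ := exists_forall_conjCocycle_ne_zero (E := E) (Γ := Γ) hi1
  obtain ⟨φ, t₀, hφ, h01, hinv, hφ1, hφt, hφneg, hφpos⟩ :=
    exists_contMDiff_separating_orbit hS (w := w) hjS (hi1.trans hij) K
  have hsm : ∀ ε : ℝ, ContMDiff 𝓘(ℝ, E) 𝓘(ℝ, ℝ) ∞ (fun q ↦ ε * φ q) :=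
    fun ε ↦ contMDiff_const.mul hφ
  have hψ : ∀ (ε s : ℝ) (q : N ⧸ Γ), ε * φ (centralExp (s • v) • q) = ε * φ q :=
    fun ε s q ↦ by rw [hinv (s • v) (S.smul_mem s hiS)]
  have hC : ∀ (ε : ℝ) (q : N ⧸ Γ), |ε * φ q| ≤ |ε| := fun ε q ↦ by
    rw [abs_mul, abs_of_nonneg (h01 q).1]
    exact mul_le_of_le_one_right (abs_nonneg _) (h01 q).2
  rintro ⟨U, hU, hrigid⟩
  let g : ℝ → (N ⧸ Γ) ≃ₘ^1⟮𝓘(ℝ, E), 𝓘(ℝ, E)⟯ (N ⧸ Γ) :=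
    fun ε ↦ perturbDiffeo hv hli (hψ ε) (hsm ε)
  have hg0 : g 0 = L.quotientDiffeo := by
    refine Diffeomorph.ext fun q ↦ ?_
    change centralExp (((0 : ℝ) * φ q) • v) • L.quotientEquiv q = L.quotientEquiv q
    simp
  have hG : ContMDiff (𝓘(ℝ, ℝ).prod 𝓘(ℝ, E)) 𝓘(ℝ, E) ∞ (fun p : ℝ × (N ⧸ Γ) ↦ g p.1 p.2) :=
    contMDiff_centralExp_smul_smul le_rfl (contMDiff_fst.mul (hφ.comp contMDiff_snd))
      ((contMDiff_quotientEquiv L).comp contMDiff_snd) v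
  have hlim := tendsto_c1Topology hG 0
  rw [hg0] at hlim
  -- `ε = 0` gives `L` itself, so `ε` is taken from a punctured neighbourhood of `0`.
  obtain ⟨ε, hεU, hε⟩ := (((hlim.eventually hU).filter_mono nhdsWithin_le_nhds).and
    (self_mem_nhdsWithin (s := {(0 : ℝ)}ᶜ))).exists
  have hconj := quotientEquiv_conjMap hv (hψ ε) hi1 (hC ε)
  have hC1 := hrigid (g ε) hεU (isC1Plus_of_contMDiff (contMDiff_perturb (hsm ε)))
    (conjHomeo hv (hψ ε) hi1 (hC ε) (hsm ε).continuous) hconj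
    (samePeriodicData_perturb hA hl i rfl (hsm ε) (hψ ε) hconj)
  refine not_hasModelDeriv_conjMap hv0 hw hi1 hij (hC ε) (by rw [hφ1, mul_zero]) (t₀ := t₀)
    (fun k ↦ by rw [hφneg, mul_zero]) ?_ _ ((hC1.1 _).hasModelDeriv one_ne_zero)
  -- Here `φ = 1`, so `|ε φ|` attains its maximum `|ε|`.
  refine hK L _ _ (by rw [hφt, mul_one]; exact hε) (fun q ↦ by rw [hφt, mul_one]; exact hC ε q)
    fun k hk ↦ ?_
  rw [iterate_quotientEquiv_centralExp_smul hw, L.iterate_quotientEquiv_one, hφpos k hk, mul_zero]
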